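/- Let $\Bbbk$ be an algebraically closed field of characteristic zero. For a finite-dimensional vector space $W$ let $\mathbb{P}(W)=\operatorname{Proj}\operatorname{Sym}(W^\vee)$ be the space of lines in $W$. A closed subscheme $Y\subset\mathbb{P}(W)$ is *arithmetically Cohen–Macaulay* if its homogeneous coordinate ring (the quotient of $\operatorname{Sym}(W^\vee)$ by the saturated homogeneous ideal of $Y$) is Cohen–Macaulay. For a subspace $V\subset W$, a nonempty scheme-theoretic intersection $Y\cap\mathbb{P}(V)$ is *dimensionally transverse* if $\dim(Y\cap\mathbb{P}(V))=\dim(Y)-\dim(W/V)$. Let $Y\subset\mathbb{P}(W)$ be an arithmetically Cohen–Macaulay closed subscheme (for instance, an arithmetically Cohen–Macaulay variety), and let $$W_2\hookrightarrow W_1\twoheadrightarrow W_0\hookrightarrow W$$ be a chain of linear maps of finite-dimensional vector spaces (injective, surjective and injective, respectively) such that the composition $W_2\to W$ is injective and $Y_2:=Y\cap\mathbb{P}(W_2)$ is nonempty and dimensionally transverse in $\mathbb{P}(W)$. Let $X\subset\mathbb{P}(W_1)$ be a pure-dimensional Cohen–Macaulay closed subscheme (for instance, a Cohen–Macaulay subvariety)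 such that 1. $X\cap\mathbb{P}(W_2)=Y_2$ as subschemes of $\mathbb{P}(W_2)$, and this intersection is dimensionally transverse in $\mathbb{P}(W_1)$; 2. the image of $X$ under the rational map $\mathbb{P}(W_1)\dashrightarrow\mathbb{P}(W)$ is contained in $Y$; that is, the morphism $X\setminus\mathbb{P}(\operatorname{Ker}(W_1\to W_0))\to\mathbb{P}(W)$ factors through $Y$. Then $Y_0:=Y\cap\mathbb{P}(W_0)$ is a dimensionally transverse intersection in $\mathbb{P}(W)$, and $$X=\operatorname{Cone}_{\mathbb{P}(\operatorname{Ker}(W_1\to W_0))}(Y_0)$$ as closed subschemes of $\mathbb{P}(W_1)$, where the right-hand side is the cone over $Y_0$ with vertex $\mathbb{P}(\operatorname{Ker}(W_1\to W_0))$, i.e. the closed subscheme of $\mathbb{P}(W_1)$ defined by the equations of $Y_0\subset\mathbb{P}(W_0)$ pulled back along $W_1\twoheadrightarrow W_0$. -/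

import Mathlib

noncomputable section

namespace ProjLinear

/-! ### Cohen-Macaulay rings -/

/-- Cohen-Macaulay condition for a local ring `R`: it is Noetherian and has a regular sequence whose
length is the Krull dimension of `R`.  (`RingTheory.Sequence.IsRegular` asks that the sequence does
not generate the unit ideal, so in a local ring its members lie in the maximal ideal.) -/
def IsCohenMacaulayLocal (R : Type*) [CommRing R] : Prop :=
  IsNoetherianRing R ∧
    ∃ rs : List R, RingTheory.Sequence.IsRegular R rs ∧ (rs.length : WithBot ℕ∞) = ringKrullDim R

/-- A Cohen-Macaulay ring: Noetherian, with Cohen-Macaulay localizations at all primes. -/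
def IsCohenMacaulayRing (R : Type*) [CommRing R] : Prop :=
  IsNoetherianRing R ∧
    ∀ (p : Ideal R) [p.IsPrime], IsCohenMacaulayLocal (Localization.AtPrime p)

/-! ### The homogeneous coordinate ring of `ℙ(W)` -/

section CoordRing

variable (k : Type*) [Field k] (W : Type*) [AddCommGroup W] [Module k W]

/-- The homogeneous coordinate ring `Sym(Wᵛ)` of `ℙ(W)`, the space of lines in `W`. -/
abbrev CoordRing := SymmetricAlgebra k (Module.Dual k W)

/-- A linear form on `W`, as an element of the coordinate ring. -/
abbrev linForm (l : Module.Dual k W) : CoordRing k W := SymmetricAlgebra.ι k (Module.Dual k W) l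

/-- The grading of `Sym(Wᵛ)` by degree: the degree `n` part is spanned by the products of `n`
linear forms. -/
abbrev grading (n : ℕ) : Submodule k (CoordRing k W) :=
  LinearMap.range (SymmetricAlgebra.ι k (Module.Dual k W)) ^ n

theorem linForm_mem (l : Module.Dual k W) : linForm k W l ∈ grading k W 1 := by
  simpa only [grading, pow_one] using LinearMap.mem_range_self _ l

open scoped DirectSum in
/-- Auxiliary for the next instance: linear forms, placed in degree one of the direct sum. -/
def gradedLinForm : Module.Dual k W →ₗ[k] ⨁ n : ℕ, ↥(grading k W n) :=
  DirectSum.lof k ℕ (fun n => ↥(grading k W n)) 1 ∘ₗ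
    (SymmetricAlgebra.ι k (Module.Dual k W)).codRestrict _ (linForm_mem k W)

theorem gradedLinForm_apply (l : Module.Dual k W) :
    gradedLinForm k W l =
      DirectSum.of (fun n : ℕ => ↥(grading k W n)) 1 ⟨linForm k W l, linForm_mem k W l⟩ :=
  rfl

instance gradedAlgebra : GradedAlgebra (grading k W) :=
  GradedAlgebra.ofAlgHom _ (SymmetricAlgebra.lift (gradedLinForm k W))
    (by
      ext l
      change DirectSum.coeAlgHom (grading k W)
        (SymmetricAlgebra.lift (gradedLinForm k W) (linForm k W l)) = linForm k W l
      rw [SymmetricAlgebra.lift_ι_apply, gradedLinForm_apply, DirectSum.coeAlgHom_of])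
    (fun n x => by
      obtain ⟨x, hx⟩ := x
      dsimp only [Subtype.coe_mk, DirectSum.lof_eq_of]
      induction hx using Submodule.pow_induction_on_left' with
      | algebraMap r =>
        rw [AlgHom.commutes, DirectSum.algebraMap_apply]; rfl
      | add x y i hx hy ihx ihy =>
        rw [map_add, ihx, ihy, ← map_add]
        rfl
      | mem_mul m hm i x hx ih =>
        obtain ⟨_, rfl⟩ := hm
        rw [map_mul, ih, SymmetricAlgebra.lift_ι_apply, gradedLinForm_apply, DirectSum.of_mul_of]
        exact DirectSum.of_eq_of_gradedMonoid_eq (Sigma.subtype_ext (add_comm _ _) rfl))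

end CoordRing

variable {k : Type*} [Field k]
variable {V : Type*} [AddCommGroup V] [Module k V]
variable {W : Type*} [AddCommGroup W] [Module k W]

/-- Substitution of a linear map `φ : V → W`: the graded homomorphism `Sym(Wᵛ) → Sym(Vᵛ)` that sends
a linear form `l` to `l ∘ φ`. -/
def pullForms (φ : V →ₗ[k] W) : grading k W →ₐᵍ[k] grading k V where
  __ := SymmetricAlgebra.lift (SymmetricAlgebra.ι k (Module.Dual k V) ∘ₗ φ.dualMap)
  map_mem {n} x hx := by
    change SymmetricAlgebra.lift (SymmetricAlgebra.ι k (Module.Dual k V) ∘ₗ φ.dualMap) x ∈ _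
    have h := Submodule.mem_map_of_mem
      (f := (SymmetricAlgebra.lift
        (SymmetricAlgebra.ι k (Module.Dual k V) ∘ₗ φ.dualMap)).toLinearMap) hx
    have hc : (SymmetricAlgebra.lift
        (SymmetricAlgebra.ι k (Module.Dual k V) ∘ₗ φ.dualMap)).toLinearMap ∘ₗ
          SymmetricAlgebra.ι k (Module.Dual k W) =
        SymmetricAlgebra.ι k (Module.Dual k V) ∘ₗ φ.dualMap :=
      SymmetricAlgebra.lift_comp_ι _
    rw [Submodule.map_pow, ← LinearMap.range_comp, hc] at h
    exact pow_le_pow_left' (LinearMap.range_comp_le_range _ _) n h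

/-- The saturation of a homogeneous ideal `I` of `Sym(Wᵛ)`: all `F` such that every linear form `l`
has a power with `l ^ n * F ∈ I`. -/
def saturation (I : HomogeneousIdeal (grading k W)) : HomogeneousIdeal (grading k W) where
  carrier := {F | ∀ l : Module.Dual k W, ∃ n : ℕ, linForm k W l ^ n * F ∈ I}
  zero_mem' := fun l => ⟨0, by simp⟩
  add_mem' := by
    intro F G hF hG l
    obtain ⟨m, hm⟩ := hF l
    obtain ⟨n, hn⟩ := hG l
    refine ⟨m + n, ?_⟩
    have h1 : linForm k W l ^ n * (linForm k W l ^ m * F) ∈ I.toIdeal := Ideal.mul_mem_left _ _ hm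
    have h2 : linForm k W l ^ m * (linForm k W l ^ n * G) ∈ I.toIdeal := Ideal.mul_mem_left _ _ hn
    have h3 := Ideal.add_mem _ h1 h2
    have h4 : linForm k W l ^ (m + n) * (F + G) = linForm k W l ^ n * (linForm k W l ^ m * F) +
        linForm k W l ^ m * (linForm k W l ^ n * G) := by ring
    rw [h4]
    exact h3
  smul_mem' := by
    intro a F hF l
    obtain ⟨n, hn⟩ := hF l
    refine ⟨n, ?_⟩
    have h : a * (linForm k W l ^ n * F) ∈ I.toIdeal := Ideal.mul_mem_left _ _ hn
    have h' : linForm k W l ^ n * (a • F) = a * (linForm k W l ^ n * F) := by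
      rw [smul_eq_mul]; ring
    rw [h']
    exact h
  is_homogeneous' := by
    intro i F hF l
    obtain ⟨n, hn⟩ := hF l
    refine ⟨n, ?_⟩
    have hl : linForm k W l ^ n ∈ grading k W n := by
      simpa using SetLike.pow_mem_graded n (linForm_mem k W l)
    have h := I.isHomogeneous (n + i) hn
    rw [DirectSum.coe_decompose_mul_add_of_left_mem (grading k W) hl] at h
    exact h

theorem mem_saturation {I : HomogeneousIdeal (grading k W)} {F : CoordRing k W} :
    F ∈ saturation I ↔ ∀ l : Module.Dual k W, ∃ n : ℕ, linForm k W l ^ n * F ∈ I :=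
  Iff.rfl

/-! ### Closed subschemes of `ℙ(W)` -/

variable (k W) in
/-- A closed subscheme of the projective space `ℙ(W) = Proj Sym(Wᵛ)` of a finite-dimensional vector
space, given by its saturated homogeneous ideal.  Equality of these ideals is equality of closed
subschemes. -/
@[ext]
structure ProjSubscheme where
  /-- The homogeneous ideal of the closed subscheme. -/
  ideal : HomogeneousIdeal (grading k W)
  saturation_le : saturation ideal ≤ ideal

/-- The closed subscheme of `ℙ(W)` cut out by a homogeneous ideal. -/
def ofIdeal (I : HomogeneousIdeal (grading k W)) : ProjSubscheme k W where
  ideal := saturation I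
  saturation_le := by
    intro F hF l
    obtain ⟨n, hn⟩ := hF l
    obtain ⟨m, hm⟩ := hn l
    refine ⟨m + n, ?_⟩
    rw [pow_add, mul_assoc]
    exact hm

namespace ProjSubscheme

/-- The underlying topological space of `X`, a closed subset of `Proj Sym(Wᵛ)`. -/
def support (X : ProjSubscheme k W) : Set (ProjectiveSpectrum (grading k W)) :=
  ProjectiveSpectrum.zeroLocus (grading k W) (X.ideal : Set (CoordRing k W))

/-- The dimension of `X`: the Krull dimension of its underlying topological space
(`⊥` if `X` is empty). -/
def dim (X : ProjSubscheme k W) : WithBot ℕ∞ :=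
  topologicalKrullDim X.support

/-- All irreducible components of `X` have the same dimension.  Every irreducible `X`, in particular
every variety in the sense of an integral closed subscheme, is pure-dimensional. -/
def IsPureDimensional (X : ProjSubscheme k W) : Prop :=
  ∀ Z ∈ irreducibleComponents X.support, topologicalKrullDim Z = X.dim

/-- The local ring `𝒪_{ℙ(W),p}` of projective space at `p`: the fractions of degree zero in the
localization of `Sym(Wᵛ)` at the homogeneous prime `p`. -/
abbrev ambientStalk (p : ProjectiveSpectrum (grading k W)) : Type _ :=
  HomogeneousLocalization.AtPrime (grading k W) p.asHomogeneousIdeal.toIdeal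

/-- The ideal of `X` in `𝒪_{ℙ(W),p}`: the fractions of degree zero that lie in the localization at
`p` of the ideal of `X`. -/
def stalkIdeal (X : ProjSubscheme k W) (p : ProjectiveSpectrum (grading k W)) :
    Ideal (ambientStalk p) :=
  (X.ideal.toIdeal.map (algebraMap (CoordRing k W)
      (Localization.AtPrime p.asHomogeneousIdeal.toIdeal))).comap
    (algebraMap (ambientStalk p) (Localization.AtPrime p.asHomogeneousIdeal.toIdeal))

/-- The local ring `𝒪_{X,p}`. -/
abbrev stalk (X : ProjSubscheme k W) (p : ProjectiveSpectrum (grading k W)) : Type _ :=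
  ambientStalk p ⧸ X.stalkIdeal p

/-- `X` is a Cohen-Macaulay scheme: all its local rings are Cohen-Macaulay. -/
def IsCohenMacaulay (X : ProjSubscheme k W) : Prop :=
  ∀ p ∈ X.support, IsCohenMacaulayLocal (X.stalk p)

/-- `X` is arithmetically Cohen-Macaulay: its homogeneous coordinate ring, the quotient of the
coordinate ring of `ℙ(W)` by the homogeneous ideal of `X`, is Cohen-Macaulay. -/
def IsACM (X : ProjSubscheme k W) : Prop :=
  IsCohenMacaulayRing (CoordRing k W ⧸ X.ideal.toIdeal)

/-- The scheme-theoretic intersection `Y ∩ ℙ(V)`, as a closed subscheme of `ℙ(V)`, where `ℙ(V)` is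
embedded in `ℙ(W)` by an injective linear map `j : V → W`: its ideal is generated, up to saturation,
by the restrictions to `V` of the equations of `Y`. -/
def linearSection (Y : ProjSubscheme k W) (j : V →ₗ[k] W) : ProjSubscheme k V :=
  ofIdeal (Y.ideal.map (pullForms j).toGradedRingHom)

/-- The cone over `Y ⊆ ℙ(W)` in `ℙ(V)` with vertex `ℙ(Ker g)`, where `g : V → W` is a surjective
linear map and `W` is identified with `V / Ker g`: it is cut out by the equations of `Y`, regarded
as polynomials on `V`. -/
def cone (Y : ProjSubscheme k W) (g : V →ₗ[k] W) : ProjSubscheme k V :=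
  ofIdeal (Y.ideal.map (pullForms g).toGradedRingHom)

/-- The (nonempty) intersection of `Y ⊆ ℙ(W)` with `ℙ(V)`, embedded by the injective linear map `j`,
is dimensionally transverse: `dim (Y ∩ ℙ(V)) = dim Y - codim ℙ(V)`, written without subtraction as
`dim (Y ∩ ℙ(V)) + dim W = dim Y + dim V`. -/
def IsDimTransverse (Y : ProjSubscheme k W) (j : V →ₗ[k] W) : Prop :=
  (Y.linearSection j).dim + (Module.finrank k W : WithBot ℕ∞) =
    Y.dim + (Module.finrank k V : WithBot ℕ∞)

/-- The image of `X ⊆ ℙ(V)` under the rational map `ℙ(V) ⇢ ℙ(W)` induced by a linear map `φ` is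
contained in `Y`.  The map is defined off `ℙ(Ker φ)`, that is, on the union of the open sets
`l ∘ φ ≠ 0` for `l ∈ Wᵛ`; the condition says that each equation `F` of `Y` becomes zero on `X` after
composition with `φ` on each of these open sets. -/
def MapsInto (X : ProjSubscheme k V) (φ : V →ₗ[k] W) (Y : ProjSubscheme k W) : Prop :=
  ∀ F ∈ Y.ideal, ∀ l : Module.Dual k W,
    ∃ n : ℕ, linForm k V (l ∘ₗ φ) ^ n * pullForms φ F ∈ X.ideal

end ProjSubscheme

end ProjLinear

end

/-! Let `E` be the ideal generated in `Sym(W₁ᵛ)` by the equations of `Y` composed with `j ∘ g`. The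
claim is that `E` is already saturated, is the ideal of the cone over `Y₀`, and equals the ideal `I`
of `X`. Dimension and depth of a homogeneous ideal are measured in the local ring at the irrelevant
ideal, i.e. at the vertex of the affine cone, where the dimension is the projective one plus one
(`krullDim_zeroLocus_add_one`).

Each linear section lowers dimension by at most its codimension. The section by `W₂` lowers `dim Y`
by exactly its codimension, so the intermediate section by `W₀` does too. Cutting the Cohen–Macaulay
affine cone of `Y` in the expected dimension keeps it Cohen–Macaulay (`LocDepthGE.map_pullHom`), and
so does adding the variables of `Ker g` (`LocDepthGE.map_pullHom_of_surjective`). Hence `E` has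
depth at least `dim X + 1`, and every associated prime of `E` has at least this dimension
(`DepthGE.le_ringKrullDim`), which exceeds `dim Ker g`. No such prime contains all forms `l ∘ g`, so
neither of the two saturations in the definition of the cone changes `E`
(`cone_linearSection_ideal`).

For `E ≤ I`: as `X` is Cohen–Macaulay and pure-dimensional, the associated primes of `I` all have
dimension `dim X + 1`, so again none of them contains all `l ∘ g`; inclusion off the vertex of the
cone gives inclusion everywhere (`map_pullHom_le_of_mapsInto`).

For `I ≤ E` (`ideal_le_of_linearSection`): otherwise some form `G` in `I` has prime annihilator `Q`
modulo `E`, with `V(Q)` of dimension at least `dim X`. For dimension reasons `V(Q)` meets `ℙ(W₂)`,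
at a generic point `p` of a component of `Y₂ = X ∩ ℙ(W₂)`. The forms cutting out `ℙ(W₂)` are a
system of parameters in the Cohen–Macaulay ring `𝒪_{X,p}`, and modulo them `E` and `I` agree at `p`;
by Nakayama `E = I` at `p` (`DepthGE.le_of_sup_ofList_eq`). So `G` vanishes modulo `E` near `p`,
contradicting `p ∈ V(Q)`. -/

namespace ProjLinear

/-! ### Depth and associated primes of cyclic modules -/

section Depth

variable {R : Type*} [CommRing R]

/-- `DepthGE 𝔞 n I`: the ideal `𝔞` contains a sequence of length `n` that is weakly regular on
`R ⧸ I`. -/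
inductive DepthGE (𝔞 : Ideal R) : ℕ → Ideal R → Prop
  | zero (I : Ideal R) : DepthGE 𝔞 0 I
  | succ {n : ℕ} {I : Ideal R} {x : R} (hx : x ∈ 𝔞) (hreg : ∀ a, x * a ∈ I → a ∈ I)
      (h : DepthGE 𝔞 n (I ⊔ Ideal.span {x})) : DepthGE 𝔞 (n + 1) I

/-- `Q` is an associated prime of `R ⧸ I`. -/
def IsAssoc (I Q : Ideal R) : Prop :=
  Q.IsPrime ∧ ∃ u, ∀ b, b ∈ Q ↔ b * u ∈ I

theorem IsAssoc.le {I Q : Ideal R} (h : IsAssoc I Q) : I ≤ Q := by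
  obtain ⟨_, u, hu⟩ := h
  intro b hb
  exact (hu b).2 (I.mul_mem_right _ hb)

theorem mem_sup_span {I : Ideal R} {x a : R} :
    a ∈ I ⊔ Ideal.span {x} ↔ ∃ i ∈ I, ∃ c, a = i + x * c := by
  rw [Submodule.mem_sup]
  constructor
  · rintro ⟨i, hi, y, hy, rfl⟩
    obtain ⟨c, rfl⟩ := Ideal.mem_span_singleton'.1 hy
    exact ⟨i, hi, c, by ring⟩
  · rintro ⟨i, hi, c, rfl⟩
    exact ⟨i, hi, _, Ideal.mem_span_singleton'.2 ⟨c, rfl⟩, by ring⟩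

theorem mk_colon_iff {I : Ideal R} {u b : R} :
    b ∈ (⊥ : Submodule R (R ⧸ I)).colon {(Ideal.Quotient.mk I u : R ⧸ I)} ↔ b * u ∈ I := by
  rw [Submodule.mem_colon_singleton, Submodule.mem_bot, ← Ideal.Quotient.eq_zero_iff_mem, map_mul]
  rfl

theorem isAssoc_iff [IsNoetherianRing R] {I Q : Ideal R} :
    IsAssoc I Q ↔ Q ∈ associatedPrimes R (R ⧸ I) := by
  rw [AssociatedPrimes.mem_iff, isAssociatedPrime_iff]
  refine and_congr_right fun _ => ⟨?_, ?_⟩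
  · rintro ⟨u, hu⟩
    exact ⟨Ideal.Quotient.mk I u, Ideal.ext fun b => (hu b).trans mk_colon_iff.symm⟩
  · rintro ⟨x, rfl⟩
    obtain ⟨u, rfl⟩ := Ideal.Quotient.mk_surjective x
    exact ⟨u, fun b => mk_colon_iff⟩

theorem exists_isAssoc [IsNoetherianRing R] {I : Ideal R} {a : R} (ha : a ∉ I) :
    ∃ Q, IsAssoc I Q ∧ ∀ b, b * a ∈ I → b ∈ Q := by
  obtain ⟨P, hP, h⟩ := exists_le_isAssociatedPrime_of_isNoetherianRing R
    (Ideal.Quotient.mk I a) (by rwa [ne_eq, Ideal.Quotient.eq_zero_iff_mem])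
  exact ⟨P, isAssoc_iff.2 hP, fun b hb => h (mk_colon_iff.2 hb)⟩

theorem regular_of_forall_isAssoc [IsNoetherianRing R] {I : Ideal R} {x : R}
    (h : ∀ Q, IsAssoc I Q → x ∉ Q) : ∀ a, x * a ∈ I → a ∈ I := by
  intro a hxa
  by_contra ha
  obtain ⟨Q, hQ, hb⟩ := exists_isAssoc ha
  exact h Q hQ (hb x hxa)

/-- Prime avoidance for the associated primes of two cyclic modules. -/
theorem exists_regular [IsNoetherianRing R] {𝔞 I J : Ideal R}
    (hI : ∀ Q, IsAssoc I Q → ¬ 𝔞 ≤ Q) (hJ : ∀ Q, IsAssoc J Q → ¬ 𝔞 ≤ Q) :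
    ∃ z ∈ 𝔞, (∀ a, z * a ∈ I → a ∈ I) ∧ ∀ a, z * a ∈ J → a ∈ J := by
  have hfin : (associatedPrimes R (R ⧸ I) ∪ associatedPrimes R (R ⧸ J)).Finite :=
    (associatedPrimes.finite R _).union (associatedPrimes.finite R _)
  by_contra! hcon
  obtain ⟨Q, hQ, hle⟩ := (𝔞.subset_union_prime_finite hfin (f := id) 0 0
    fun Q hQ _ _ => by rcases hQ with hQ | hQ <;> exact hQ.isPrime).1 <| by
      intro z hz
      by_contra hn
      simp only [Set.mem_iUnion, not_exists] at hn
      obtain ⟨a, ha, ha'⟩ := hcon z hz <| regular_of_forall_isAssoc fun Q hQ hzQ =>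
        hn Q (Or.inl (isAssoc_iff.1 hQ)) hzQ
      exact ha' (regular_of_forall_isAssoc (fun Q hQ hzQ =>
        hn Q (Or.inr (isAssoc_iff.1 hQ)) hzQ) a ha)
  rcases hQ with hQ | hQ
  · exact hI Q (isAssoc_iff.2 hQ) hle
  · exact hJ Q (isAssoc_iff.2 hQ) hle

theorem regular_map_localization (M : Submonoid R) (S : Type*) [CommRing S] [Algebra R S]
    [IsLocalization M S] {I : Ideal R} {x : R} (hreg : ∀ a, x * a ∈ I → a ∈ I) :
    ∀ a, algebraMap R S x * a ∈ I.map (algebraMap R S) → a ∈ I.map (algebraMap R S) := by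
  intro a ha
  obtain ⟨⟨a, s⟩, rfl⟩ := IsLocalization.mk'_surjective M a
  have h1 : algebraMap R S (x * a) ∈ I.map (algebraMap R S) := by
    have := Ideal.mul_mem_right (algebraMap R S s) _ ha
    rwa [mul_assoc, IsLocalization.mk'_spec, ← map_mul] at this
  obtain ⟨m, hm, hmem⟩ := (IsLocalization.algebraMap_mem_map_algebraMap_iff M S I _).1 h1
  rw [IsLocalization.mk'_mem_map_algebraMap_iff M S]
  exact ⟨m, hm, hreg _ (by convert hmem using 1; ring)⟩

namespace DepthGE

theorem of_succ {𝔞 : Ideal R} {n : ℕ} {I : Ideal R} (h : DepthGE 𝔞 (n + 1) I) :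
    DepthGE 𝔞 n I := by
  induction n generalizing I with
  | zero => exact .zero _
  | succ n ih =>
    cases h with
    | succ hx hreg h => exact .succ hx hreg (ih h)

theorem of_le {𝔞 : Ideal R} {m n : ℕ} (hmn : m ≤ n) {I : Ideal R} (h : DepthGE 𝔞 n I) :
    DepthGE 𝔞 m I := by
  induction hmn with
  | refl => exact h
  | step _ ih => exact ih h.of_succ

theorem mono {𝔞 𝔟 : Ideal R} (hab : 𝔞 ≤ 𝔟) {n : ℕ} {I : Ideal R} (h : DepthGE 𝔞 n I) :
    DepthGE 𝔟 n I := by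
  induction h with
  | zero => exact .zero _
  | succ hx hreg _ ih => exact .succ (hab hx) hreg ih

/-- Depth does not depend on the choice of the first element of a regular sequence. -/
theorem sup_span [IsNoetherianRing R] {𝔞 : Ideal R} {n : ℕ} {I : Ideal R}
    (h : DepthGE 𝔞 (n + 1) I) {x : R} (hx : x ∈ 𝔞) (hreg : ∀ a, x * a ∈ I → a ∈ I) :
    DepthGE 𝔞 n (I ⊔ Ideal.span {x}) := by
  induction n generalizing I x with
  | zero => exact .zero _
  | succ n ih =>
    cases h with
    | @succ _ _ y hy hyreg h =>
    -- Modulo `I + (y)` there is still a regular element in `𝔞`, so no nonzero class is killed by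
    -- `𝔞`.
    have hsocy : ∀ u, (∀ z ∈ 𝔞, z * u ∈ I ⊔ Ideal.span {y}) → u ∈ I ⊔ Ideal.span {y} := by
      cases h with
      | succ hw hwreg _ => exact fun u hu => hwreg u (hu _ hw)
    -- The same for `x`: the elements killed by `𝔞` in `R ⧸ I + (x)` and in `R ⧸ I + (y)`
    -- correspond, both being `Ext¹(R ⧸ 𝔞, R ⧸ I)`. The correspondence sends `u` to the `v` with `y
    -- * u = x * v` modulo `I`.
    have hsocx : ∀ u, (∀ z ∈ 𝔞, z * u ∈ I ⊔ Ideal.span {x}) → u ∈ I ⊔ Ideal.span {x} := by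
      intro u hu
      obtain ⟨i, hi, v, hv⟩ := mem_sup_span.1 (hu y hy)
      have hv' : v ∈ I ⊔ Ideal.span {y} := by
        refine hsocy v fun z hz => ?_
        obtain ⟨i', hi', w, hw⟩ := mem_sup_span.1 (hu z hz)
        -- `x * (z * v) = z * y * u - z * i = y * (i' + x * w) - z * i`
        have h1 : x * (z * v - y * w) ∈ I := by
          have : x * (z * v - y * w) = y * i' - z * i := by
            linear_combination (-z) * hv + y * hw
          rw [this]
          exact I.sub_mem (I.mul_mem_left _ hi') (I.mul_mem_left _ hi)
        exact mem_sup_span.2 ⟨_, hreg _ h1, w, by ring⟩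
      obtain ⟨i', hi', w, rfl⟩ := mem_sup_span.1 hv'
      have h1 : y * (u - x * w) ∈ I := by
        have : y * (u - x * w) = i + x * i' := by linear_combination hv
        rw [this]
        exact I.add_mem hi (I.mul_mem_left _ hi')
      exact mem_sup_span.2 ⟨_, hyreg _ h1, w, by ring⟩
    have key : ∀ K : Ideal R, (∀ u, (∀ z ∈ 𝔞, z * u ∈ K) → u ∈ K) →
        ∀ Q, IsAssoc K Q → ¬ 𝔞 ≤ Q := by
      rintro K hK Q ⟨hQ, u, hu⟩ hle
      exact hQ.ne_top ((Ideal.eq_top_iff_one _).2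
        ((hu 1).2 (by simpa using hK u fun z hz => (hu z).1 (hle hz))))
    -- An element `z` regular modulo both `I + (x)` and `I + (y)` mediates the exchange: `y` is
    -- replaced by `z`, then `z` by `x`, each time with the induction hypothesis one step lower.
    obtain ⟨z, hz, hzx, hzy⟩ := exists_regular (key _ hsocx) (key _ hsocy)
    have swap : ∀ w, (∀ a, w * a ∈ I → a ∈ I) →
        (∀ a, z * a ∈ I ⊔ Ideal.span {w} → a ∈ I ⊔ Ideal.span {w}) →
        ∀ a, w * a ∈ I ⊔ Ideal.span {z} → a ∈ I ⊔ Ideal.span {z} := by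
      intro w hw hzw a ha
      obtain ⟨i, hi, b, hb⟩ := mem_sup_span.1 ha
      have h1 : z * b ∈ I ⊔ Ideal.span {w} :=
        mem_sup_span.2 ⟨-i, I.neg_mem hi, a, by linear_combination -hb⟩
      obtain ⟨i', hi', c, rfl⟩ := mem_sup_span.1 (hzw b h1)
      have h2 : w * (a - z * c) ∈ I := by
        have : w * (a - z * c) = i + z * i' := by linear_combination hb
        rw [this]
        exact I.add_mem hi (I.mul_mem_left _ hi')
      exact mem_sup_span.2 ⟨_, hw _ h2, c, by ring⟩
    have hzreg : ∀ a, z * a ∈ I → a ∈ I ⊔ Ideal.span {y} := fun a ha =>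
      hzy a ((le_sup_left : I ≤ _) ha)
    have h3 := ih h hz hzy
    rw [sup_right_comm] at h3
    have h4 : DepthGE 𝔞 (n + 1) (I ⊔ Ideal.span {z}) := .succ hy (swap y hyreg hzy) h3
    have h5 := ih h4 hx (swap x hreg hzx)
    rw [sup_right_comm] at h5
    exact .succ hz hzx h5

/-- The depth of `S ⧸ J` does not depend on whether `R` or `S` acts: regular sequences lift along
`f`, because the preimage of `J + (f x)` is the preimage of `J` plus `(x)`. -/
theorem comap_of_surjective {S : Type*} [CommRing S] (f : R →+* S)
    (hf : Function.Surjective f) {𝔟 : Ideal S} {n : ℕ} {J : Ideal S} (h : DepthGE 𝔟 n J) :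
    DepthGE (𝔟.comap f) n (J.comap f) := by
  induction h with
  | zero => exact .zero _
  | @succ n J x hx hreg _ ih =>
    obtain ⟨x, rfl⟩ := hf x
    refine .succ (x := x) hx (fun a ha => hreg _ (by simpa using ha)) ?_
    convert ih using 1
    ext a
    rw [Ideal.mem_comap, mem_sup_span, mem_sup_span]
    constructor
    · rintro ⟨i, hi, c, rfl⟩
      exact ⟨f i, hi, f c, by simp⟩
    · rintro ⟨i, hi, c, hc⟩
      obtain ⟨c, rfl⟩ := hf c
      refine ⟨a - x * c, ?_, c, by ring⟩
      rw [Ideal.mem_comap, map_sub, map_mul, hc]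
      simpa using hi

theorem map_of_surjective {S : Type*} [CommRing S] (f : R →+* S)
    (hf : Function.Surjective f) {𝔞 : Ideal R} {n : ℕ} {J : Ideal S}
    (h : DepthGE 𝔞 n (J.comap f)) : DepthGE (𝔞.map f) n J := by
  generalize hI : J.comap f = I at h
  induction h generalizing J with
  | zero => exact .zero _
  | @succ n I x hx hreg _ ih =>
    subst hI
    refine .succ (x := f x) (Ideal.mem_map_of_mem f hx) (fun a ha => ?_) (ih ?_)
    · obtain ⟨a, rfl⟩ := hf a
      exact hreg a (by simpa using ha)
    · ext a
      rw [Ideal.mem_comap, mem_sup_span, mem_sup_span]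
      constructor
      · rintro ⟨i, hi, c, hc⟩
        obtain ⟨c, rfl⟩ := hf c
        refine ⟨a - x * c, ?_, c, by ring⟩
        rw [Ideal.mem_comap, map_sub, map_mul, hc]
        simpa using hi
      · rintro ⟨i, hi, c, rfl⟩
        exact ⟨f i, hi, f c, by simp⟩

theorem map_localization (M : Submonoid R) (S : Type*) [CommRing S] [Algebra R S]
    [IsLocalization M S] {𝔞 : Ideal R} {n : ℕ} {I : Ideal R} (h : DepthGE 𝔞 n I) :
    DepthGE (𝔞.map (algebraMap R S)) n (I.map (algebraMap R S)) := by
  induction h with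
  | zero => exact .zero _
  | @succ n I x hx hreg _ ih =>
    refine .succ (x := algebraMap R S x) (Ideal.mem_map_of_mem _ hx)
      (regular_map_localization M S hreg) ?_
    rwa [Ideal.map_sup, Ideal.map_span, Set.image_singleton] at ih

end DepthGE

end Depth

end ProjLinear

namespace ProjLinear

/-! ### Dimension of quotients of Noetherian local rings -/

section Dimension

variable {R : Type*} [CommRing R]

theorem ringKrullDim_quotient_le_of_le {I J : Ideal R} (h : I ≤ J) :
    ringKrullDim (R ⧸ J) ≤ ringKrullDim (R ⧸ I) :=
  ringKrullDim_le_of_surjective (Ideal.Quotient.factor h) (Ideal.Quotient.factor_surjective h)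

theorem ringKrullDim_quotient_succ_le_of_lt {P Q : Ideal R} [P.IsPrime] (h : P < Q) :
    ringKrullDim (R ⧸ Q) + 1 ≤ ringKrullDim (R ⧸ P) := by
  obtain ⟨x, hxQ, hxP⟩ := SetLike.exists_of_lt h
  refine ringKrullDim_succ_le_of_surjective (Ideal.Quotient.factor h.le)
    (Ideal.Quotient.factor_surjective h.le) (r := Ideal.Quotient.mk P x) ?_ ?_
  · exact mem_nonZeroDivisors_of_ne_zero (by rwa [ne_eq, Ideal.Quotient.eq_zero_iff_mem])
  · rw [Ideal.Quotient.factor_mk, Ideal.Quotient.eq_zero_iff_mem]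
    exact hxQ

theorem ringKrullDim_quotient_succ_le_of_regular {I : Ideal R} {x : R}
    (h : ∀ a, x * a ∈ I → a ∈ I) :
    ringKrullDim (R ⧸ I ⊔ Ideal.span {x}) + 1 ≤ ringKrullDim (R ⧸ I) := by
  refine ringKrullDim_succ_le_of_surjective (Ideal.Quotient.factor le_sup_left)
    (Ideal.Quotient.factor_surjective le_sup_left) (r := Ideal.Quotient.mk I x) ?_ ?_
  · rw [mem_nonZeroDivisors_iff_right]
    intro y hy
    obtain ⟨y, rfl⟩ := Ideal.Quotient.mk_surjective y
    rw [← map_mul, Ideal.Quotient.eq_zero_iff_mem, mul_comm] at hy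
    exact Ideal.Quotient.eq_zero_iff_mem.2 (h y hy)
  · rw [Ideal.Quotient.factor_mk, Ideal.Quotient.eq_zero_iff_mem]
    exact Ideal.mem_sup_right (Ideal.mem_span_singleton_self x)

variable [IsNoetherianRing R] [IsLocalRing R]

open IsLocalRing

theorem ringKrullDim_quotient_le_succ (I : Ideal R) {x : R} (hx : x ∈ maximalIdeal R) :
    ringKrullDim (R ⧸ I) ≤ ringKrullDim (R ⧸ I ⊔ Ideal.span {x}) + 1 := by
  rcases eq_or_ne I ⊤ with rfl | hI
  · have : Subsingleton (R ⧸ (⊤ : Ideal R)) := Ideal.Quotient.subsingleton_iff.2 rfl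
    rw [ringKrullDim_eq_bot_of_subsingleton]
    exact bot_le
  have : Nontrivial (R ⧸ I) := Ideal.Quotient.nontrivial_iff.2 hI
  have : IsLocalRing (R ⧸ I) := .of_surjective' _ Ideal.Quotient.mk_surjective
  have hmem : Ideal.Quotient.mk I x ∈ maximalIdeal (R ⧸ I) := by
    rw [mem_maximalIdeal, mem_nonunits_iff]
    intro hu
    obtain ⟨y, hy⟩ := hu.exists_right_inv
    obtain ⟨y, rfl⟩ := Ideal.Quotient.mk_surjective y
    rw [← map_mul, ← map_one (Ideal.Quotient.mk I), Ideal.Quotient.eq] at hy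
    have h1 := (maximalIdeal R).sub_mem ((maximalIdeal R).mul_mem_right y hx)
      (le_maximalIdeal hI hy)
    rw [sub_sub_cancel] at h1
    exact (Ideal.ne_top_iff_one _).1 (maximalIdeal.isMaximal R).ne_top h1
  have h := ringKrullDim_le_ringKrullDim_quotient_add_card {Ideal.Quotient.mk I x} (by
    simpa [ringJacobson_eq_maximalIdeal] using hmem)
  rw [Finset.coe_singleton, Finset.card_singleton, ← Set.image_singleton, ← Ideal.map_span,
    ringKrullDim_eq_of_ringEquiv (DoubleQuot.quotQuotEquivQuotSup I (Ideal.span {x}))] at h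
  exact_mod_cast h

theorem ringKrullDim_quotient_le_add_length (I : Ideal R) (L : List R)
    (hL : ∀ x ∈ L, x ∈ maximalIdeal R) :
    ringKrullDim (R ⧸ I) ≤ ringKrullDim (R ⧸ I ⊔ Ideal.ofList L) + L.length := by
  induction L generalizing I with
  | nil => simpa using ringKrullDim_quotient_le_of_le (Ideal.ofList_nil (R := R) ▸ sup_bot_eq I).le
  | cons x L ih =>
    refine (ringKrullDim_quotient_le_succ I (hL x (by simp))).trans ?_
    refine (add_le_add_left (ih (I ⊔ Ideal.span {x}) fun y hy => hL y (by simp [hy])) 1).trans ?_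
    rw [Ideal.ofList_cons, sup_assoc, List.length_cons, add_assoc]
    exact_mod_cast le_rfl

namespace DepthGE

/-- Associated primes of `R ⧸ I` have dimension at least the depth of `R ⧸ I`. -/
theorem le_ringKrullDim {n : ℕ} {I Q : Ideal R} (h : DepthGE (maximalIdeal R) n I)
    (hQ : IsAssoc I Q) : (n : WithBot ℕ∞) ≤ ringKrullDim (R ⧸ Q) := by
  induction n generalizing I Q with
  | zero =>
    have := hQ.1
    exact_mod_cast ringKrullDim_nonneg_of_nontrivial
  | succ n ih =>
    have hQp := hQ.1
    obtain ⟨u, hu⟩ := hQ.2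
    cases h with
    | @succ _ _ x hx hreg h =>
    have hxQ : x ∉ Q := fun hxQ => hQp.ne_top <| (Ideal.eq_top_iff_one _).2 <|
      (hu 1).2 (by simpa using hreg u ((hu x).1 hxQ))
    -- Let `N` consist of the elements killed by `Q` modulo `I`. If `N` were inside `I + (x)`,
    -- regularity of `x` would give `N ≤ I + xN`, and Nakayama would put the witness `u` in `I`.
    obtain ⟨a, haQ, ha⟩ : ∃ a, (∀ q ∈ Q, q * a ∈ I) ∧ a ∉ I ⊔ Ideal.span {x} := by
      by_contra! hcon
      let N : Ideal R := { carrier := {a | ∀ q ∈ Q, q * a ∈ I}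
                           add_mem' := fun {a b} ha hb q hq => by
                            rw [mul_add]; exact I.add_mem (ha q hq) (hb q hq)
                           zero_mem' := fun q _ => by simp
                           smul_mem' := fun c a ha q hq => by
                            rw [smul_eq_mul, mul_left_comm]; exact I.mul_mem_left _ (ha q hq) }
      have hN : N ≤ I := by
        refine Submodule.le_of_le_smul_of_le_jacobson_bot (I := maximalIdeal R)
          (IsNoetherian.noetherian N) (maximalIdeal_le_jacobson _) fun a ha => ?_
        obtain ⟨i, hi, c, rfl⟩ := mem_sup_span.1 (hcon a ha)
        refine Submodule.add_mem_sup hi (Submodule.smul_mem_smul hx fun q hq => hreg _ ?_)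
        have h1 := I.sub_mem (ha q hq) (I.mul_mem_left q hi)
        convert h1 using 1
        ring
      have huI : u ∈ I := hN fun q hq => (hu q).1 hq
      exact hQp.ne_top ((Ideal.eq_top_iff_one _).2 ((hu 1).2 (by simpa using huI)))
    -- An associated prime of `I + (x)` containing the annihilator of `a` contains both `Q` and `x`,
    -- so it is strictly larger than `Q`, and induction applies to it.
    obtain ⟨Q', hQ', hle⟩ := exists_isAssoc ha
    have hlt : Q < Q' := by
      refine lt_of_le_of_ne (fun q hq => hle q (Ideal.mem_sup_left (haQ q hq))) ?_
      rintro rfl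
      exact hxQ (hQ'.le (Ideal.mem_sup_right (Ideal.mem_span_singleton_self x)))
    have h1 := (add_le_add_left (ih h hQ') 1).trans (ringKrullDim_quotient_succ_le_of_lt hlt)
    exact_mod_cast h1

/-- The depth forces `dim R ⧸ Q ≥ d + |L| + 1`. If `x` were in `Q`, then `L` alone would cut `R ⧸ Q`
down to dimension `d`, yet each element lowers dimension by at most one. -/
theorem not_mem_of_isAssoc {d : ℕ} {I Q : Ideal R} {x : R} {L : List R}
    (hL : ∀ y ∈ L, y ∈ maximalIdeal R)
    (hd : ringKrullDim (R ⧸ (I ⊔ Ideal.span {x}) ⊔ Ideal.ofList L) ≤ d)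
    (h : DepthGE (maximalIdeal R) (d + L.length + 1) I) (hQ : IsAssoc I Q) : x ∉ Q := by
  intro hxQ
  have h1 := h.le_ringKrullDim hQ
  have h2 := ringKrullDim_quotient_le_add_length Q L hL
  have h3 : ringKrullDim (R ⧸ Q ⊔ Ideal.ofList L) ≤ d :=
    (ringKrullDim_quotient_le_of_le (sup_le_sup_right
      (sup_le hQ.le ((Ideal.span_singleton_le_iff_mem _).2 hxQ)) _)).trans hd
  have h4 := h1.trans (h2.trans (add_le_add_left h3 _))
  have h5 : d + L.length + 1 ≤ d + L.length := by exact_mod_cast h4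
  omega

/-- In a Cohen-Macaulay quotient, elements cutting down the dimension by the expected amount form a
regular sequence. -/
theorem sup_ofList {d : ℕ} {I : Ideal R} (L₁ L₂ : List R)
    (hL₁ : ∀ y ∈ L₁, y ∈ maximalIdeal R) (hL₂ : ∀ y ∈ L₂, y ∈ maximalIdeal R)
    (hd : ringKrullDim (R ⧸ (I ⊔ Ideal.ofList L₁) ⊔ Ideal.ofList L₂) ≤ d)
    (h : DepthGE (maximalIdeal R) (d + L₂.length + L₁.length) I) :
    DepthGE (maximalIdeal R) (d + L₂.length) (I ⊔ Ideal.ofList L₁) := by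
  induction L₁ generalizing I with
  | nil => simpa using h
  | cons x L ih =>
    rw [Ideal.ofList_cons, ← sup_assoc] at hd ⊢
    refine ih (fun y hy => hL₁ y (by simp [hy])) hd ?_
    refine DepthGE.sup_span (by simpa [add_assoc] using h) (hL₁ x (by simp))
      (regular_of_forall_isAssoc fun Q hQ => ?_)
    -- After `x`, the elements still to be used are those of `L` and `L₂` together; they bring the
    -- dimension down to `d`, so `x` has to avoid the associated primes of `I`.
    refine not_mem_of_isAssoc (d := d) (L := L₂ ++ L) ?_ ?_ (by simpa [add_assoc] using h) hQ
    · intro y hy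
      rcases List.mem_append.1 hy with hy | hy
      · exact hL₂ y hy
      · exact hL₁ y (by simp [hy])
    · rwa [Ideal.ofList_append, sup_comm (Ideal.ofList L₂), ← sup_assoc]

/-- Two ideals, the larger one with Cohen-Macaulay quotient, agree as soon as they do modulo a
system of parameters of the latter. -/
theorem le_of_sup_ofList_eq {E I : Ideal R} (hEI : E ≤ I) (L : List R)
    (hL : ∀ y ∈ L, y ∈ maximalIdeal R)
    (hd : ringKrullDim (R ⧸ I ⊔ Ideal.ofList L) ≤ 0)
    (h : DepthGE (maximalIdeal R) L.length I)
    (heq : I ⊔ Ideal.ofList L ≤ E ⊔ Ideal.ofList L) : I ≤ E := by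
  induction L generalizing I E with
  | nil => simpa using heq
  | cons x L ih =>
    have hx := hL x (by simp)
    have hL' : ∀ y ∈ L, y ∈ maximalIdeal R := fun y hy => hL y (by simp [hy])
    rw [Ideal.ofList_cons, ← sup_assoc] at hd
    rw [Ideal.ofList_cons, ← sup_assoc, ← sup_assoc] at heq
    have hreg : ∀ a, x * a ∈ I → a ∈ I := regular_of_forall_isAssoc fun Q hQ =>
      not_mem_of_isAssoc (d := 0) hL' (by exact_mod_cast hd) (by simpa using h) hQ
    have h1 := ih (sup_le_sup_right hEI _) hL' hd (DepthGE.sup_span (by simpa using h) hx hreg) heq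
    -- Writing `a ∈ I` as `e + x * c` with `e ∈ E ≤ I`, regularity of `x` modulo `I` gives `c ∈ I`.
    -- Thus `I ≤ E + 𝔪I`, and Nakayama concludes.
    refine Submodule.le_of_le_smul_of_le_jacobson_bot (I := maximalIdeal R)
      (IsNoetherian.noetherian I) (maximalIdeal_le_jacobson _) fun a ha => ?_
    obtain ⟨e, he, c, rfl⟩ := mem_sup_span.1 (h1 (Ideal.mem_sup_left ha))
    refine Submodule.add_mem_sup he (Submodule.smul_mem_smul hx (hreg _ ?_))
    simpa using I.sub_mem ha (hEI he)

end DepthGE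

end Dimension

open IsLocalRing in
theorem depthGE_of_isRegular {R : Type*} [CommRing R] [IsLocalRing R] {rs : List R}
    (h : RingTheory.Sequence.IsRegular R rs) :
    DepthGE (maximalIdeal R) rs.length ⊥ := by
  have hmem : ∀ x ∈ rs, x ∈ maximalIdeal R := by
    intro x hx
    have hne : Ideal.ofList rs ≠ ⊤ := by
      have := h.top_ne_smul
      rw [smul_eq_mul, Ideal.mul_top] at this
      exact this.symm
    exact le_maximalIdeal hne (Ideal.subset_span hx)
  have key : ∀ n i, i + n = rs.length →
      DepthGE (maximalIdeal R) n (Ideal.ofList (rs.take i)) := by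
    intro n
    induction n with
    | zero => exact fun i _ => .zero _
    | succ n ih =>
      intro i hi
      have hlt : i < rs.length := by omega
      refine .succ (x := rs[i]) (hmem _ (List.getElem_mem hlt)) (fun a ha => ?_) ?_
      · have h1 := h.regular_mod_prev i hlt
        rw [smul_eq_mul, Ideal.mul_top] at h1
        rw [← Ideal.Quotient.eq_zero_iff_mem] at ha ⊢
        apply h1
        exact ha.trans (smul_zero rs[i]).symm
      · have h2 := ih (i + 1) (by omega)
        rwa [List.take_add_one, List.getElem?_eq_getElem hlt, Option.toList_some,
          Ideal.ofList_append, Ideal.ofList_singleton] at h2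
  have h0 := key rs.length 0 (by simp)
  simpa using h0

end ProjLinear

namespace ProjLinear

/-! ### Localization of associated primes and catenarity of Cohen–Macaulay local rings -/

section Catenary

variable {R : Type*} [CommRing R]

theorem IsAssoc.map_localization (M : Submonoid R) (S : Type*) [CommRing S] [Algebra R S]
    [IsLocalization M S] {I Q : Ideal R} (h : IsAssoc I Q) (hd : Disjoint (M : Set R) Q) :
    IsAssoc (I.map (algebraMap R S)) (Q.map (algebraMap R S)) := by
  obtain ⟨hQ, u, hu⟩ := h
  refine ⟨IsLocalization.isPrime_of_isPrime_disjoint M S Q hQ hd, algebraMap R S u, fun b => ?_⟩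
  obtain ⟨⟨b, s⟩, rfl⟩ := IsLocalization.mk'_surjective M b
  have h1 : IsLocalization.mk' S b s * algebraMap R S u = IsLocalization.mk' S (b * u) s := by
    rw [mul_comm, IsLocalization.mul_mk'_eq_mk'_of_mul, mul_comm]
  simp only [h1, IsLocalization.mk'_mem_map_algebraMap_iff M S]
  refine exists_congr fun m => and_congr_right fun _ => ?_
  rw [hu, mul_assoc]

theorem isAssoc_of_mem_minimalPrimes [IsNoetherianRing R] {I P : Ideal R}
    (h : P ∈ I.minimalPrimes) : IsAssoc I P := by
  rw [isAssoc_iff]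
  refine Module.associatedPrimes.minimalPrimes_annihilator_subset_associatedPrimes R (R ⧸ I) ?_
  rwa [Ideal.annihilator_quotient]

/-- The bound includes `I = ⊤`, where the hypothesis is vacuous and the dimension is `⊥`. -/
theorem ringKrullDim_quotient_le_zero [IsLocalRing R] {I : Ideal R}
    (h : ∀ q : Ideal R, q.IsPrime → I ≤ q → q = IsLocalRing.maximalIdeal R) :
    ringKrullDim (R ⧸ I) ≤ 0 := by
  have : Ring.KrullDimLE 0 (R ⧸ I) := by
    rw [Ring.krullDimLE_zero_iff]
    intro J hJ
    have h1 : J.comap (Ideal.Quotient.mk I) = IsLocalRing.maximalIdeal R :=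
      h _ inferInstance (by
        intro x hx
        rw [Ideal.mem_comap, Ideal.Quotient.eq_zero_iff_mem.2 hx]
        exact J.zero_mem)
    rw [← Ideal.map_comap_of_surjective _ Ideal.Quotient.mk_surjective J]
    have : (J.comap (Ideal.Quotient.mk I)).IsMaximal := h1 ▸ inferInstance
    exact .map_of_surjective_of_ker_le Ideal.Quotient.mk_surjective
      (RingHom.ker_eq_comap_bot (Ideal.Quotient.mk I) ▸ Ideal.comap_mono bot_le)
  exact_mod_cast Ring.krullDimLE_iff.1 this

theorem le_of_add_one_le_coe {x : WithBot ℕ∞} {t : ℕ} (h : x + 1 ≤ ((t + 1 : ℕ) : WithBot ℕ∞)) :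
    x ≤ t := by
  induction x with
  | bot => exact bot_le
  | coe x =>
    induction x with
    | top =>
      have h1 : (⊤ : ℕ∞) + 1 ≤ ((t + 1 : ℕ) : ℕ∞) := by exact_mod_cast h
      simp at h1
    | coe x => exact_mod_cast (Nat.le_of_succ_le_succ (by exact_mod_cast h) : x ≤ t)

variable [IsNoetherianRing R] [IsLocalRing R]

open IsLocalRing

/-- The grade of `p` is at least the depth minus `dim R ⧸ p`: while the depth exceeds `b`, all
associated primes have dimension above `b`, so none contains `p`, and prime avoidance finds the next
regular element inside `p`. -/
theorem DepthGE.of_ringKrullDim_le {p : Ideal R} {b : ℕ} (hb : ringKrullDim (R ⧸ p) ≤ b)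
    {s : ℕ} {I : Ideal R} (h : DepthGE (maximalIdeal R) (s + b) I) (hp : p ≠ ⊤) :
    DepthGE p s I := by
  induction s generalizing I with
  | zero => exact .zero _
  | succ s ih =>
    have hav : ∀ Q, IsAssoc I Q → ¬ p ≤ Q := by
      intro Q hQ hle
      have h1 := (h.le_ringKrullDim hQ).trans ((ringKrullDim_quotient_le_of_le hle).trans hb)
      have h2 : s + 1 + b ≤ b := by exact_mod_cast h1
      omega
    obtain ⟨z, hz, hreg, -⟩ := exists_regular hav hav
    refine .succ hz hreg (ih ?_)
    exact DepthGE.sup_span (by rwa [add_right_comm] at h) (le_maximalIdeal hp hz) hreg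

/-- A form of catenarity for Cohen-Macaulay local rings: if the prime `p` is minimal over
`P + (x₁, …, xₑ)`, then `dim R/P ≤ dim R/p + e`. -/
theorem le_add_length_of_mem_minimalPrimes {n : ℕ} (h : DepthGE (maximalIdeal R) n ⊥)
    (hn : ringKrullDim R ≤ n) {P p : Ideal R} [P.IsPrime] {L : List R}
    (hp : p ∈ (P ⊔ Ideal.ofList L).minimalPrimes) {a b : ℕ}
    (ha : a ≤ ringKrullDim (R ⧸ P)) (hb : ringKrullDim (R ⧸ p) ≤ b) : a ≤ b + L.length := by
  have hpp : p.IsPrime := hp.1.1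
  have hPp : P ≤ p := le_sup_left.trans hp.1.2
  obtain ⟨a', ha'⟩ : ∃ a' : ℕ, ringKrullDim (R ⧸ P) = a' := by
    have h1 : ringKrullDim (R ⧸ P) ≤ n := (ringKrullDim_quotient_le P).trans hn
    generalize ringKrullDim (R ⧸ P) = x at ha h1
    induction x with
    | bot => exact absurd ha (by simp)
    | coe x =>
      induction x with
      | top =>
        have h2 : (⊤ : ℕ∞) ≤ (n : ℕ∞) := by exact_mod_cast h1
        simp at h2
      | coe x => exact ⟨x, rfl⟩
  have haa : a ≤ a' := by rw [ha'] at ha; exact_mod_cast ha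
  have han : a' ≤ n := by
    have h1 := (ringKrullDim_quotient_le P).trans hn
    rw [ha'] at h1
    exact_mod_cast h1
  by_cases hab : a' ≤ b
  · omega
  -- `J` is generated by a regular sequence of length `s` inside `P`, so `R ⧸ J` keeps depth `t = n
  -- - s` and has dimension at most `t`. The last clause records that the depth with respect to `p`
  -- drops by no more than `s`. The sequence can be prolonged while `t > dim R ⧸ P`.
  have key : ∀ s t, s + t = n → a' ≤ t → ∃ J ≤ P, DepthGE (maximalIdeal R) t J ∧
      ringKrullDim (R ⧸ J) ≤ t ∧ ∀ r, DepthGE p (r + s) ⊥ → DepthGE p r J := by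
    intro s
    induction s with
    | zero =>
      intro t ht _
      obtain rfl : t = n := by omega
      exact ⟨⊥, bot_le, h, (ringKrullDim_quotient_le _).trans hn, fun r hr => hr⟩
    | succ s ih =>
      intro t ht hat
      obtain ⟨J, hJP, hJ, hJd, hJp⟩ := ih (t + 1) (by omega) (by omega)
      have hav : ∀ Q, IsAssoc J Q → ¬ P ≤ Q := by
        intro Q hQ hle
        have h1 := (hJ.le_ringKrullDim hQ).trans ((ringKrullDim_quotient_le_of_le hle).trans ha'.le)
        have h2 : t + 1 ≤ a' := by exact_mod_cast h1
        omega
      obtain ⟨z, hz, hreg, -⟩ := exists_regular hav hav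
      refine ⟨J ⊔ Ideal.span {z}, sup_le hJP ((Ideal.span_singleton_le_iff_mem _).2 hz),
        DepthGE.sup_span hJ (le_maximalIdeal hpp.ne_top (hPp hz)) hreg, ?_, fun r hr => ?_⟩
      · exact le_of_add_one_le_coe ((ringKrullDim_quotient_succ_le_of_regular hreg).trans hJd)
      · exact DepthGE.sup_span (hJp (r + 1) (by convert hr using 1; ring)) (hPp hz) hreg
  obtain ⟨J, hJP, -, hJd, hJp⟩ := key (n - a') a' (by omega) le_rfl
  have hPJ : P ∈ J.minimalPrimes := by
    refine ⟨⟨inferInstance, hJP⟩, fun q hq hqP => ?_⟩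
    by_contra hPq
    have := hq.1
    have h1 := (ringKrullDim_quotient_succ_le_of_lt (lt_of_le_not_ge hqP hPq)).trans
      ((ringKrullDim_quotient_le_of_le hq.2).trans hJd)
    rw [ha'] at h1
    have h2 : a' + 1 ≤ a' := by exact_mod_cast h1
    omega
  -- The depth of `R` with respect to `p` is at least `n - b`, and `J` uses up `n - a'` of it. After
  -- localization at `p`, the associated prime `P` of `J` then has dimension at least `a' - b`,
  -- while `L` cuts it to dimension zero.
  have hdp : DepthGE p (a' - b) J := hJp _ <|
    DepthGE.of_ringKrullDim_le hb (h.of_le (by omega)) hpp.ne_top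
  let S := Localization.AtPrime p
  have hloc := hdp.map_localization p.primeCompl S
  rw [Localization.AtPrime.map_eq_maximalIdeal] at hloc
  have hdisj : Disjoint (p.primeCompl : Set R) P :=
    Set.disjoint_left.2 fun x hx hxP => hx (hPp hxP)
  have h1 := hloc.le_ringKrullDim
    ((isAssoc_of_mem_minimalPrimes hPJ).map_localization p.primeCompl S hdisj)
  have hLmem : ∀ y ∈ L.map (algebraMap R S), y ∈ maximalIdeal S := by
    intro y hy
    obtain ⟨x, hx, rfl⟩ := List.mem_map.1 hy
    rw [← Localization.AtPrime.map_eq_maximalIdeal]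
    exact Ideal.mem_map_of_mem _ (hp.1.2 (Ideal.mem_sup_right (Ideal.subset_span hx)))
  have h2 := ringKrullDim_quotient_le_add_length (P.map (algebraMap R S))
    (L.map (algebraMap R S)) hLmem
  have h3 : ringKrullDim (S ⧸ P.map (algebraMap R S) ⊔ Ideal.ofList (L.map (algebraMap R S))) ≤
      (0 : ℕ) := by
    refine ringKrullDim_quotient_le_zero fun q hq hle => ?_
    rw [← Ideal.map_ofList, ← Ideal.map_sup, Ideal.map_le_iff_le_comap] at hle
    have hqp : q.comap (algebraMap R S) ≤ p := by
      intro x hx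
      by_contra hxp
      exact hq.ne_top (q.eq_top_of_isUnit_mem hx (IsLocalization.map_units S (⟨x, hxp⟩ : p.primeCompl)))
    have h4 := hp.2 ⟨inferInstance, hle⟩ hqp
    refine le_antisymm (le_maximalIdeal hq.ne_top) ?_
    rw [← Localization.AtPrime.map_eq_maximalIdeal, Ideal.map_le_iff_le_comap]
    exact h4
  have h4 := h1.trans (h2.trans (add_le_add_left h3 _))
  rw [List.length_map] at h4
  have h5 : a' - b ≤ 0 + L.length := by exact_mod_cast h4
  omega

end Catenary

end ProjLinear

namespace ProjLinear

/-! ### Depth and dimension at a prime -/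

section LocalData

open IsLocalRing

variable {A B : Type*} [CommRing A] [CommRing B]

/-- The depth of the localization of `A ⧸ I` at `p` is at least `n`. -/
def LocDepthGE (p : Ideal A) [p.IsPrime] (n : ℕ) (I : Ideal A) : Prop :=
  DepthGE (maximalIdeal (Localization.AtPrime p)) n
    (I.map (algebraMap A (Localization.AtPrime p)))

/-- The dimension of the localization of `A ⧸ I` at `p`. -/
noncomputable def locDim (p : Ideal A) [p.IsPrime] (I : Ideal A) : WithBot ℕ∞ :=
  ringKrullDim (Localization.AtPrime p ⧸ I.map (algebraMap A (Localization.AtPrime p)))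

section Surjective

variable {f : A →+* B} (hf : Function.Surjective f) (p : Ideal A) [p.IsPrime] (q : Ideal B)
  [q.IsPrime] (hpq : p = q.comap f)

include hf

theorem localRingHom_surjective : Function.Surjective (Localization.localRingHom p q f hpq) := by
  intro x
  obtain ⟨⟨b, s, hs⟩, rfl⟩ := IsLocalization.mk'_surjective q.primeCompl x
  obtain ⟨a, rfl⟩ := hf b
  obtain ⟨t, rfl⟩ := hf s
  have ht : t ∈ p.primeCompl := by
    rw [Ideal.mem_primeCompl_iff, hpq]
    exact hs
  exact ⟨IsLocalization.mk' _ a ⟨t, ht⟩, Localization.localRingHom_mk' _ _ _ hpq _ _⟩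

theorem comap_localRingHom_map (J : Ideal B) :
    (J.map (algebraMap B (Localization.AtPrime q))).comap (Localization.localRingHom p q f hpq) =
      (J.comap f).map (algebraMap A (Localization.AtPrime p)) := by
  ext x
  obtain ⟨⟨a, s⟩, rfl⟩ := IsLocalization.mk'_surjective p.primeCompl x
  rw [Ideal.mem_comap, Localization.localRingHom_mk',
    IsLocalization.mk'_mem_map_algebraMap_iff q.primeCompl,
    IsLocalization.mk'_mem_map_algebraMap_iff p.primeCompl]
  constructor
  · rintro ⟨m, hm, hmem⟩
    obtain ⟨t, rfl⟩ := hf m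
    refine ⟨t, ?_, ?_⟩
    · rw [Ideal.mem_primeCompl_iff, hpq]
      exact hm
    · simpa using hmem
  · rintro ⟨m, hm, hmem⟩
    refine ⟨f m, ?_, by simpa using hmem⟩
    rw [Ideal.mem_primeCompl_iff, hpq] at hm
    exact hm

include hpq

/-- The map of local rings is surjective and local, and the preimage of the extension of `J` is the
extension of its preimage, so both sides speak of the same quotient ring. It is applied to
restriction of forms to a linear subspace and to the quotient by the ideal of `Y`. -/
theorem locDepthGE_comap_iff {n : ℕ} {J : Ideal B} :
    LocDepthGE p n (J.comap f) ↔ LocDepthGE q n J := by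
  have hs := localRingHom_surjective hf p q hpq
  have hc := comap_localRingHom_map hf p q hpq J
  have hm : (maximalIdeal (Localization.AtPrime q)).comap
      (Localization.localRingHom p q f hpq) = maximalIdeal (Localization.AtPrime p) :=
    ((local_hom_TFAE (Localization.localRingHom p q f hpq)).out 0 4).1
      (Localization.isLocalHom_localRingHom p q f hpq)
  constructor
  · intro h
    rw [LocDepthGE, ← hc, ← hm] at h
    exact (h.map_of_surjective _ hs).mono Ideal.map_comap_le
  · intro h
    have h1 := h.comap_of_surjective _ hs
    rwa [hc, hm] at h1

theorem locDim_comap {J : Ideal B} : locDim p (J.comap f) = locDim q J := by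
  have hs := localRingHom_surjective hf p q hpq
  have hc := comap_localRingHom_map hf p q hpq J
  rw [locDim, ← hc]
  let e := RingHom.quotientKerEquivOfSurjective
    (f := (Ideal.Quotient.mk (J.map (algebraMap B (Localization.AtPrime q)))).comp
      (Localization.localRingHom p q f hpq)) (Ideal.Quotient.mk_surjective.comp hs)
  rw [locDim, ← ringKrullDim_eq_of_ringEquiv e]
  refine ringKrullDim_eq_of_ringEquiv (Ideal.quotEquivOfEq ?_)
  rw [← RingHom.comap_ker, Ideal.mk_ker]

end Surjective

variable {p : Ideal A} [p.IsPrime]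

theorem mem_maximalIdeal_of_mem {x : A} (hx : x ∈ p) :
    algebraMap A (Localization.AtPrime p) x ∈ maximalIdeal (Localization.AtPrime p) := by
  rw [← Localization.AtPrime.map_eq_maximalIdeal]
  exact Ideal.mem_map_of_mem _ hx

theorem forall_mem_map_of_forall_mem {L : List A} (hL : ∀ x ∈ L, x ∈ p) :
    ∀ y ∈ L.map (algebraMap A (Localization.AtPrime p)), y ∈ maximalIdeal _ := by
  intro y hy
  obtain ⟨x, hx, rfl⟩ := List.mem_map.1 hy
  exact mem_maximalIdeal_of_mem (hL x hx)

theorem locDim_anti {I J : Ideal A} (h : I ≤ J) : locDim p J ≤ locDim p I :=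
  ringKrullDim_quotient_le_of_le (Ideal.map_mono h)

theorem locDim_succ_le_of_lt {P Q : Ideal A} [P.IsPrime] [Q.IsPrime] (h : P < Q) (hQ : Q ≤ p) :
    locDim p Q + 1 ≤ locDim p P := by
  have hd : ∀ {P : Ideal A}, P ≤ p → Disjoint (p.primeCompl : Set A) P :=
    fun hP => Set.disjoint_left.2 fun x hx hxP => hx (hP hxP)
  have := IsLocalization.isPrime_of_isPrime_disjoint p.primeCompl (Localization.AtPrime p) P
    inferInstance (hd (h.le.trans hQ))
  refine ringKrullDim_quotient_succ_le_of_lt (lt_of_le_of_ne (Ideal.map_mono h.le) fun heq => ?_)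
  have h1 := IsLocalization.under_map_of_isPrime_disjoint p.primeCompl (Localization.AtPrime p)
    (I := P) inferInstance (hd (h.le.trans hQ))
  have h2 := IsLocalization.under_map_of_isPrime_disjoint p.primeCompl (Localization.AtPrime p)
    (I := Q) inferInstance (hd hQ)
  rw [heq, h2] at h1
  exact h.ne h1.symm

theorem locDim_nonneg {I : Ideal A} (h : I ≤ p) : 0 ≤ locDim p I := by
  have : Nontrivial (Localization.AtPrime p ⧸ I.map (algebraMap A (Localization.AtPrime p))) := by
    rw [Ideal.Quotient.nontrivial_iff]
    intro htop
    have h1 := Ideal.map_mono (f := algebraMap A (Localization.AtPrime p)) h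
    rw [htop, Localization.AtPrime.map_eq_maximalIdeal, top_le_iff] at h1
    exact (maximalIdeal.isMaximal _).ne_top h1
  exact ringKrullDim_nonneg_of_nontrivial

/-- Some prime `Q ⊇ I` has dimension at least that of `I`, if the latter is finite. -/
theorem exists_minimalPrimes_le_locDim {I : Ideal A} {d : ℕ} (hd : d ≤ locDim p I) :
    ∃ Q ∈ I.minimalPrimes, Q ≤ p ∧ d ≤ locDim p Q := by
  rw [locDim, ringKrullDim_quotient, Order.le_krullDim_iff] at hd
  obtain ⟨l, hl⟩ := hd
  let S := Localization.AtPrime p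
  have hhead : I.map (algebraMap A S) ≤ l.head.1.asIdeal := l.head.2
  have hprime := l.head.1.isPrime
  obtain ⟨Q, hQ, hQle⟩ := Ideal.exists_minimalPrimes_le (I := I)
    (J := l.head.1.asIdeal.comap (algebraMap A S)) (Ideal.map_le_iff_le_comap.1 hhead)
  refine ⟨Q, hQ, hQle.trans fun x hx => ?_, ?_⟩
  · by_contra hxp
    exact hprime.ne_top (Ideal.eq_top_of_isUnit_mem _ hx
      (IsLocalization.map_units S (⟨x, hxp⟩ : p.primeCompl)))
  · rw [locDim, ringKrullDim_quotient, Order.le_krullDim_iff]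
    have hmem : ∀ i, (l i).1 ∈ PrimeSpectrum.zeroLocus
        (Q.map (algebraMap A S) : Set S) := by
      intro i
      have h1 : l.head.1.asIdeal ≤ (l i).1.asIdeal := l.monotone (Fin.zero_le i)
      exact (Ideal.map_le_iff_le_comap.2 hQle).trans h1
    exact ⟨⟨l.length, fun i => ⟨(l i).1, hmem i⟩, fun i => l.step i⟩, hl⟩

theorem LocDepthGE.succ {n : ℕ} {I : Ideal A} {x : A} (hx : x ∈ p) (hreg : ∀ a, x * a ∈ I → a ∈ I)
    (h : LocDepthGE p n (I ⊔ Ideal.span {x})) : LocDepthGE p (n + 1) I := by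
  refine DepthGE.succ (mem_maximalIdeal_of_mem hx) ?_ ?_ (n := n)
  · exact regular_map_localization p.primeCompl _ hreg
  · rwa [LocDepthGE, Ideal.map_sup, Ideal.map_span, Set.image_singleton] at h

variable [IsNoetherianRing A]

theorem LocDepthGE.le_locDim {n : ℕ} {I Q : Ideal A} (h : LocDepthGE p n I) (hQ : IsAssoc I Q)
    (hQp : Q ≤ p) : n ≤ locDim p Q :=
  DepthGE.le_ringKrullDim h (hQ.map_localization p.primeCompl _
    (Set.disjoint_left.2 fun _ hx hxQ => hx (hQp hxQ)))

theorem locDim_le_add_length (I : Ideal A) {L : List A} (hL : ∀ x ∈ L, x ∈ p) :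
    locDim p I ≤ locDim p (I ⊔ Ideal.ofList L) + L.length := by
  have h := ringKrullDim_quotient_le_add_length (I.map (algebraMap A (Localization.AtPrime p))) _
    (forall_mem_map_of_forall_mem hL)
  rwa [← Ideal.map_ofList, ← Ideal.map_sup, List.length_map] at h

theorem LocDepthGE.sup_ofList {d : ℕ} {I : Ideal A} (L₁ L₂ : List A)
    (hL₁ : ∀ y ∈ L₁, y ∈ p) (hL₂ : ∀ y ∈ L₂, y ∈ p)
    (hd : locDim p ((I ⊔ Ideal.ofList L₁) ⊔ Ideal.ofList L₂) ≤ d)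
    (h : LocDepthGE p (d + L₂.length + L₁.length) I) :
    LocDepthGE p (d + L₂.length) (I ⊔ Ideal.ofList L₁) := by
  have h1 := DepthGE.sup_ofList (d := d) (I := I.map (algebraMap A (Localization.AtPrime p)))
    (L₁.map (algebraMap A _)) (L₂.map (algebraMap A _)) (forall_mem_map_of_forall_mem hL₁)
    (forall_mem_map_of_forall_mem hL₂)
  rw [← Ideal.map_ofList, ← Ideal.map_ofList, ← Ideal.map_sup, ← Ideal.map_sup, List.length_map,
    List.length_map] at h1
  exact h1 hd h

/-- A form of catenarity at a prime of Cohen-Macaulay local ring. -/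
theorem LocDepthGE.le_add_length_of_mem_minimalPrimes {n : ℕ} (h : LocDepthGE p n ⊥)
    (hn : locDim p ⊥ ≤ n) {P Q : Ideal A} [P.IsPrime] {L : List A}
    (hQ : Q ∈ (P ⊔ Ideal.ofList L).minimalPrimes) (hQp : Q ≤ p) {a b : ℕ}
    (ha : a ≤ locDim p P) (hb : locDim p Q ≤ b) : a ≤ b + L.length := by
  let S := Localization.AtPrime p
  have hd : ∀ {P : Ideal A}, P ≤ p → Disjoint (p.primeCompl : Set A) P :=
    fun hP => Set.disjoint_left.2 fun x hx hxP => hx (hP hxP)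
  have hPQ : P ≤ Q := le_sup_left.trans hQ.1.2
  have := IsLocalization.isPrime_of_isPrime_disjoint p.primeCompl S P
    inferInstance (hd (hPQ.trans hQp))
  rw [LocDepthGE, Ideal.map_bot] at h
  have hn' : ringKrullDim S ≤ n := by
    rw [locDim, Ideal.map_bot] at hn
    rwa [← ringKrullDim_eq_of_ringEquiv (RingEquiv.quotientBot S)]
  have hm : Q.map (algebraMap A S) ∈
      (P.map (algebraMap A S) ⊔ Ideal.ofList (L.map (algebraMap A S))).minimalPrimes := by
    have hQprime := hQ.1.1
    rw [← Ideal.map_ofList, ← Ideal.map_sup]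
    refine ⟨⟨IsLocalization.isPrime_of_isPrime_disjoint p.primeCompl S Q hQprime (hd hQp),
      Ideal.map_mono hQ.1.2⟩, fun q hq hqQ => ?_⟩
    have := hq.1
    rw [Ideal.map_le_iff_le_comap]
    refine hQ.2 ⟨inferInstance, Ideal.map_le_iff_le_comap.1 hq.2⟩ ?_
    rw [← IsLocalization.under_map_of_isPrime_disjoint p.primeCompl S hQprime (hd hQp)]
    exact Ideal.comap_mono hqQ
  have h2 := ProjLinear.le_add_length_of_mem_minimalPrimes h hn' hm ha hb
  rwa [List.length_map] at h2

end LocalData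

end ProjLinear

namespace ProjLinear

/-! ### Substitution homomorphisms and the irrelevant ideal -/

section CoordRingLemmas

variable {k : Type*} [Field k]
variable {V : Type*} [AddCommGroup V] [Module k V]
variable {W : Type*} [AddCommGroup W] [Module k W]
variable {U : Type*} [AddCommGroup U] [Module k U]

/-- The algebra homomorphism underlying `pullForms`. -/
noncomputable def pullHom (φ : V →ₗ[k] W) : CoordRing k W →ₐ[k] CoordRing k V :=
  SymmetricAlgebra.lift (SymmetricAlgebra.ι k (Module.Dual k V) ∘ₗ φ.dualMap)

@[simp]
theorem pullHom_linForm (φ : V →ₗ[k] W) (l : Module.Dual k W) :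
    pullHom φ (linForm k W l) = linForm k V (l ∘ₗ φ) :=
  SymmetricAlgebra.lift_ι_apply _ _

@[simp]
theorem linForm_zero : linForm k V 0 = 0 := map_zero (SymmetricAlgebra.ι k (Module.Dual k V))

theorem pullHom_comp (φ : V →ₗ[k] W) (ψ : U →ₗ[k] V) :
    pullHom (φ ∘ₗ ψ) = (pullHom ψ).comp (pullHom φ) := by
  apply SymmetricAlgebra.algHom_ext
  ext l
  change pullHom _ (linForm k W l) = pullHom ψ (pullHom φ (linForm k W l))
  simp [LinearMap.comp_assoc]

theorem pullHom_pullHom (φ : V →ₗ[k] W) (ψ : U →ₗ[k] V) (F : CoordRing k W) :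
    pullHom ψ (pullHom φ F) = pullHom (φ ∘ₗ ψ) F := by
  rw [pullHom_comp]
  rfl

theorem map_pullHom_comp (φ : V →ₗ[k] W) (ψ : U →ₗ[k] V) (I : Ideal (CoordRing k W)) :
    I.map (pullHom (φ ∘ₗ ψ)).toRingHom =
      (I.map (pullHom φ).toRingHom).map (pullHom ψ).toRingHom := by
  rw [Ideal.map_map, pullHom_comp]
  rfl

theorem pullHom_id : pullHom (LinearMap.id : V →ₗ[k] V) = AlgHom.id k _ := by
  apply SymmetricAlgebra.algHom_ext
  ext l
  exact pullHom_linForm _ l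

/-- Two algebra homomorphisms that agree on linear forms modulo `J` agree modulo `J`. -/
theorem sub_mem_of_linForm {B : Type*} [CommRing B] [Algebra k B] {J : Ideal B}
    {f g : CoordRing k V →ₐ[k] B} (h : ∀ l, f (linForm k V l) - g (linForm k V l) ∈ J)
    (F : CoordRing k V) : f F - g F ∈ J := by
  have h1 : (Ideal.Quotient.mkₐ k J).comp f = (Ideal.Quotient.mkₐ k J).comp g := by
    apply SymmetricAlgebra.algHom_ext
    ext l
    exact Ideal.Quotient.eq.2 (h l)
  exact Ideal.Quotient.eq.1 (DFunLike.congr_fun h1 F)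

variable (k V) in
/-- The irrelevant ideal: polynomials without constant term. -/
noncomputable def irrel : Ideal (CoordRing k V) :=
  RingHom.ker (SymmetricAlgebra.algebraMapInv : CoordRing k V →ₐ[k] k).toRingHom

theorem mem_irrel {F : CoordRing k V} :
    F ∈ irrel k V ↔ (SymmetricAlgebra.algebraMapInv : CoordRing k V →ₐ[k] k) F = 0 :=
  Iff.rfl

instance irrel_isPrime : (irrel k V).IsPrime := RingHom.ker_isPrime _

theorem linForm_mem_irrel (l : Module.Dual k V) : linForm k V l ∈ irrel k V :=
  mem_irrel.2 (SymmetricAlgebra.algebraMapInv_ι l)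

/-- Linear substitutions preserve constant terms. This makes the local rings at the two irrelevant
ideals comparable. -/
theorem comap_irrel (φ : V →ₗ[k] W) :
    irrel k W = (irrel k V).comap (pullHom φ).toRingHom := by
  have h : (SymmetricAlgebra.algebraMapInv : CoordRing k W →ₐ[k] k) =
      (SymmetricAlgebra.algebraMapInv : CoordRing k V →ₐ[k] k).comp (pullHom φ) := by
    apply SymmetricAlgebra.algHom_ext
    ext l
    change SymmetricAlgebra.algebraMapInv (linForm k W l) =
      SymmetricAlgebra.algebraMapInv (pullHom φ (linForm k W l))
    rw [pullHom_linForm, SymmetricAlgebra.algebraMapInv_ι, SymmetricAlgebra.algebraMapInv_ι]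
  ext F
  rw [mem_irrel, h]
  rfl

theorem irrel_le_of_linForm_mem {I : Ideal (CoordRing k V)} (h : ∀ l, linForm k V l ∈ I) :
    irrel k V ≤ I := by
  intro F hF
  have h1 := sub_mem_of_linForm (J := I) (f := AlgHom.id k (CoordRing k V))
    (g := (Algebra.ofId k (CoordRing k V)).comp SymmetricAlgebra.algebraMapInv) (fun l => ?_) F
  · simpa [mem_irrel.1 hF] using h1
  · have h2 : (SymmetricAlgebra.algebraMapInv : CoordRing k V →ₐ[k] k) (linForm k V l) = 0 :=
      SymmetricAlgebra.algebraMapInv_ι l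
    simpa [h2] using h l

instance isNoetherianRing_coordRing [FiniteDimensional k V] : IsNoetherianRing (CoordRing k V) :=
  isNoetherianRing_of_ringEquiv _
    (SymmetricAlgebra.equivMvPolynomial
      (Module.finBasis k (Module.Dual k V))).symm.toRingEquiv

theorem pullHom_surjective {j : V →ₗ[k] W} (hj : Function.Injective j) :
    Function.Surjective (pullHom j).toRingHom := by
  obtain ⟨r, hr⟩ := j.exists_leftInverse_of_injective (LinearMap.ker_eq_bot.2 hj)
  intro F
  refine ⟨pullHom r F, ?_⟩
  change pullHom j (pullHom r F) = F
  rw [pullHom_pullHom, hr, pullHom_id]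
  rfl

theorem exists_list_span [FiniteDimensional k V] (K : Submodule k V) :
    ∃ L : List V, L.length = Module.finrank k K ∧ (∀ x ∈ L, x ∈ K) ∧
      ∀ x ∈ K, x ∈ Submodule.span k {y | y ∈ L} := by
  let b := Module.finBasis k K
  refine ⟨List.ofFn fun i => (b i).1, by simp, fun x hx => ?_, fun x hx => ?_⟩
  · obtain ⟨i, rfl⟩ := List.mem_ofFn.1 hx
    exact (b i).2
  · have h1 := congrArg Subtype.val (b.sum_repr ⟨x, hx⟩)
    rw [Submodule.coe_sum] at h1
    change _ = x at h1
    rw [← h1]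
    exact Submodule.sum_mem _ fun i _ => Submodule.smul_mem _ _
      (Submodule.subset_span (List.mem_ofFn.2 ⟨i, rfl⟩))

/-- Linear forms that cut out the linear subspace `V` of `W`. -/
theorem exists_forms [FiniteDimensional k W] [FiniteDimensional k V] {j : V →ₗ[k] W}
    (hj : Function.Injective j) : ∃ L : List (CoordRing k W),
      (∀ x ∈ L, ∃ l : Module.Dual k W, x = linForm k W l ∧ l ∘ₗ j = 0) ∧
      L.length + Module.finrank k V = Module.finrank k W ∧
      RingHom.ker (pullHom j).toRingHom = Ideal.ofList L := by
  obtain ⟨N, hNlen, hNK, hNspan⟩ := exists_list_span (LinearMap.ker j.dualMap)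
  let L := N.map (linForm k W)
  have hL : ∀ x ∈ L, ∃ l : Module.Dual k W, x = linForm k W l ∧ l ∘ₗ j = 0 := by
    intro x hx
    obtain ⟨l, hl, rfl⟩ := List.mem_map.1 hx
    exact ⟨l, rfl, hNK l hl⟩
  have hmem : ∀ l ∈ LinearMap.ker j.dualMap, linForm k W l ∈ Ideal.ofList L := by
    intro l hl
    have h1 : Submodule.span k {x | x ∈ N} ≤ ((Ideal.ofList L).restrictScalars k).comap
        (SymmetricAlgebra.ι k (Module.Dual k W)) :=
      Submodule.span_le.2 fun x hx => Ideal.subset_span (List.mem_map.2 ⟨x, hx, rfl⟩)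
    exact h1 (hNspan l hl)
  refine ⟨L, hL, ?_, le_antisymm (fun F hF => ?_) ?_⟩
  · have h1 := LinearMap.finrank_range_add_finrank_ker j.dualMap
    rw [LinearMap.range_eq_top.2 (LinearMap.dualMap_surjective_of_injective hj), finrank_top,
      Subspace.dual_finrank_eq, Subspace.dual_finrank_eq] at h1
    rw [List.length_map, hNlen, add_comm]
    exact h1
  · obtain ⟨r, hr⟩ := j.exists_leftInverse_of_injective (LinearMap.ker_eq_bot.2 hj)
    have h1 := sub_mem_of_linForm (J := Ideal.ofList L) (f := AlgHom.id k (CoordRing k W))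
      (g := (pullHom r).comp (pullHom j)) (fun l => ?_) F
    · have hF' : pullHom j F = 0 := hF
      simpa [hF'] using h1
    · change linForm k W l - pullHom r (pullHom j (linForm k W l)) ∈ _
      rw [pullHom_linForm, pullHom_linForm, ← map_sub]
      refine hmem _ ?_
      rw [LinearMap.mem_ker]
      change (l - (l ∘ₗ j) ∘ₗ r) ∘ₗ j = 0
      rw [LinearMap.sub_comp, LinearMap.comp_assoc, hr, LinearMap.comp_id, sub_self]
  · refine Ideal.span_le.2 fun x hx => ?_
    obtain ⟨l, rfl, hl⟩ := hL x hx
    change pullHom j (linForm k W l) = 0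
    rw [pullHom_linForm, hl, linForm_zero]

/-! ### Linear sections and cones at the level of local depth -/

/-- Restricting equations to the subspace amounts to adjoining the linear forms that cut it out, so
sections can be studied inside the ambient ring. -/
theorem comap_map_pullHom {j : V →ₗ[k] W} (hj : Function.Injective j)
    {L : List (CoordRing k W)} (hL : RingHom.ker (pullHom j).toRingHom = Ideal.ofList L)
    (I : Ideal (CoordRing k W)) :
    (I.map (pullHom j).toRingHom).comap (pullHom j).toRingHom = I ⊔ Ideal.ofList L := by
  rw [Ideal.comap_map_of_surjective' _ (pullHom_surjective hj), hL]

theorem locDim_map_pullHom {j : V →ₗ[k] W} (hj : Function.Injective j)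
    {L : List (CoordRing k W)} (hL : RingHom.ker (pullHom j).toRingHom = Ideal.ofList L)
    (I : Ideal (CoordRing k W)) :
    locDim (irrel k V) (I.map (pullHom j).toRingHom) =
      locDim (irrel k W) (I ⊔ Ideal.ofList L) := by
  rw [← comap_map_pullHom hj hL I, locDim_comap (pullHom_surjective hj) _ _ (comap_irrel j)]

theorem mem_irrel_of_forms {j : V →ₗ[k] W} {L : List (CoordRing k W)}
    (hL : ∀ x ∈ L, ∃ l : Module.Dual k W, x = linForm k W l ∧ l ∘ₗ j = 0) :
    ∀ x ∈ L, x ∈ irrel k W := by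
  intro x hx
  obtain ⟨l, rfl, -⟩ := hL x hx
  exact linForm_mem_irrel l

/-- Adding one variable raises the depth by one. -/
theorem LocDepthGE.map_pullHom_of_section {π : V →ₗ[k] W} {s : W →ₗ[k] V} {t : Module.Dual k V}
    {v : V} (hπs : π ∘ₗ s = LinearMap.id) (hts : t ∘ₗ s = 0) (htv : t v = 1) (hπv : π v = 0)
    (hdec : ∀ x, x = s (π x) + t x • v) {n : ℕ} {I : Ideal (CoordRing k W)}
    (h : LocDepthGE (irrel k W) n I) :
    LocDepthGE (irrel k V) (n + 1) (I.map (pullHom π).toRingHom) := by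
  have hs : Function.Injective s := fun x y hxy => by
    have h1 := congrArg π hxy
    rwa [← LinearMap.comp_apply, ← LinearMap.comp_apply, hπs] at h1
  have hsπ : ∀ F, pullHom s (pullHom π F) = F := fun F => by
    rw [pullHom_pullHom, hπs, pullHom_id]
    rfl
  -- Setting the new variable `t` to zero turns the extended ideal back into `I`; the depth of `I`
  -- is therefore the depth modulo `t`.
  have hK : (I.comap (pullHom s).toRingHom) =
      I.map (pullHom π).toRingHom ⊔ Ideal.span {linForm k V t} := by
    apply le_antisymm
    · intro F hF
      have h1 := sub_mem_of_linForm (J := Ideal.span {linForm k V t})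
        (f := AlgHom.id k (CoordRing k V)) (g := (pullHom π).comp (pullHom s)) (fun l => ?_) F
      · rw [← sub_add_cancel F (pullHom π (pullHom s F))]
        exact add_mem (Ideal.mem_sup_right h1)
          (Ideal.mem_sup_left (Ideal.mem_map_of_mem (pullHom π).toRingHom hF))
      · change linForm k V l - pullHom π (pullHom s (linForm k V l)) ∈ _
        rw [pullHom_linForm, pullHom_linForm, ← map_sub]
        have h2 : l - (l ∘ₗ s) ∘ₗ π = l v • t := by
          ext x
          have h3 := congrArg l (hdec x)
          rw [map_add, map_smul] at h3
          simp only [LinearMap.sub_apply, LinearMap.comp_apply, LinearMap.smul_apply, smul_eq_mul]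
            at h3 ⊢
          linear_combination h3
        rw [h2, map_smul, Algebra.smul_def]
        exact Ideal.mul_mem_left _ _ (Ideal.mem_span_singleton_self _)
    · refine sup_le ?_ ?_
      · rw [Ideal.map_le_iff_le_comap]
        intro F hF
        change pullHom s (pullHom π F) ∈ I
        rwa [hsπ]
      · rw [Ideal.span_singleton_le_iff_mem]
        change pullHom s (linForm k V t) ∈ I
        rw [pullHom_linForm, hts, linForm_zero]
        exact I.zero_mem
  refine LocDepthGE.succ (linForm_mem_irrel t) ?_ ?_
  · let f : Module.Dual k V →ₗ[k] Polynomial (CoordRing k W) :=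
      (Algebra.linearMap (CoordRing k W) (Polynomial (CoordRing k W))).restrictScalars k ∘ₗ
        SymmetricAlgebra.ι k (Module.Dual k W) ∘ₗ s.dualMap +
      (LinearMap.toSpanSingleton k _ (Polynomial.X : Polynomial (CoordRing k W))) ∘ₗ
        (LinearMap.applyₗ v)
    let Φ : CoordRing k V →ₐ[k] Polynomial (CoordRing k W) := SymmetricAlgebra.lift f
    have hΦ : ∀ l, Φ (linForm k V l) =
        Polynomial.C (linForm k W (l ∘ₗ s)) + l v • Polynomial.X := fun l =>
      SymmetricAlgebra.lift_ι_apply f l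
    have hΦπ : ∀ F, Φ (pullHom π F) = Polynomial.C F := by
      have h1 : Φ.comp (pullHom π) =
          (IsScalarTower.toAlgHom k (CoordRing k W) (Polynomial (CoordRing k W))) := by
        apply SymmetricAlgebra.algHom_ext
        ext1 l
        change Φ (pullHom π (linForm k W l)) = Polynomial.C (linForm k W l)
        rw [pullHom_linForm, hΦ, LinearMap.comp_assoc, hπs, LinearMap.comp_id,
          LinearMap.comp_apply, hπv, map_zero, zero_smul, add_zero]
      exact fun F => DFunLike.congr_fun h1 F
    let Ψ : Polynomial (CoordRing k W) →+* CoordRing k V :=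
      Polynomial.eval₂RingHom (pullHom π).toRingHom (linForm k V t)
    have hΨΦ : ∀ F, Ψ (Φ F) = F := by
      let Ψ' : Polynomial (CoordRing k W) →ₐ[k] CoordRing k V :=
        { Ψ with
          commutes' := fun r => by
            change Ψ (Polynomial.C (algebraMap k (CoordRing k W) r)) = _
            simp [Ψ] }
      have h1 : Ψ'.comp Φ = AlgHom.id k _ := by
        apply SymmetricAlgebra.algHom_ext
        ext1 l
        change Ψ (Φ (linForm k V l)) = linForm k V l
        rw [hΦ, Algebra.smul_def, map_add, map_mul]
        have h2 : Ψ (algebraMap k (Polynomial (CoordRing k W)) (l v)) =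
            algebraMap k (CoordRing k V) (l v) := Ψ'.commutes _
        have h3 : Ψ (Polynomial.C (linForm k W (l ∘ₗ s))) = linForm k V ((l ∘ₗ s) ∘ₗ π) := by
          rw [← pullHom_linForm π]
          exact Polynomial.eval₂_C _ _
        have h4 : Ψ Polynomial.X = linForm k V t := Polynomial.eval₂_X _ _
        rw [h2, h3, h4, ← Algebra.smul_def, ← map_smul, ← map_add]
        congr 1
        ext x
        have h5 := congrArg l (hdec x)
        rw [map_add, map_smul] at h5
        simp only [LinearMap.add_apply, LinearMap.comp_apply, LinearMap.smul_apply, smul_eq_mul]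
          at h5 ⊢
        linear_combination -h5
      exact fun F => DFunLike.congr_fun h1 F
    have hmem : ∀ F, F ∈ I.map (pullHom π).toRingHom ↔ Φ F ∈ I.map Polynomial.C := by
      intro F
      constructor
      · intro hF
        have h1 : I.map (pullHom π).toRingHom ≤ (I.map Polynomial.C).comap Φ.toRingHom := by
          rw [Ideal.map_le_iff_le_comap]
          intro G hG
          have h2 : Φ (pullHom π G) = Polynomial.C G := hΦπ G
          change Φ (pullHom π G) ∈ I.map Polynomial.C
          rw [h2]
          exact Ideal.mem_map_of_mem _ hG
        exact h1 hF
      · intro hF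
        have h1 : I.map Polynomial.C ≤ (I.map (pullHom π).toRingHom).comap Ψ := by
          rw [Ideal.map_le_iff_le_comap]
          intro G hG
          have h2 : Ψ (Polynomial.C G) = pullHom π G := Polynomial.eval₂_C _ _
          rw [Ideal.mem_comap, Ideal.mem_comap, h2]
          exact Ideal.mem_map_of_mem (pullHom π).toRingHom hG
        have h2 := h1 hF
        rwa [Ideal.mem_comap, hΨΦ] at h2
    intro F hF
    rw [hmem] at hF ⊢
    have h1 : Φ (linForm k V t * F) = Φ F * Polynomial.X := by
      rw [map_mul, hΦ, hts, htv, linForm_zero, map_zero, zero_add, one_smul, mul_comm]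
    rw [h1, Ideal.mem_map_C_iff] at hF
    rw [Ideal.mem_map_C_iff]
    intro n
    simpa using hF (n + 1)
  · rw [← hK, locDepthGE_comap_iff (pullHom_surjective hs) _ _ (comap_irrel s)]
    exact h

variable [FiniteDimensional k W] [FiniteDimensional k V] [FiniteDimensional k U]

theorem locDim_le_locDim_map_add {j : V →ₗ[k] W} (hj : Function.Injective j) {c : ℕ}
    (hc : c + Module.finrank k V = Module.finrank k W) (I : Ideal (CoordRing k W)) :
    locDim (irrel k W) I ≤ locDim (irrel k V) (I.map (pullHom j).toRingHom) + c := by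
  obtain ⟨L, hL, hlen, hker⟩ := exists_forms hj
  obtain rfl : L.length = c := by omega
  rw [locDim_map_pullHom hj hker]
  exact locDim_le_add_length I (mem_irrel_of_forms hL)

/-- A linear section, of the expected dimension, of a Cohen-Macaulay cone is Cohen-Macaulay. -/
theorem LocDepthGE.map_pullHom {j : V →ₗ[k] W} (hj : Function.Injective j) {i : U →ₗ[k] V}
    (hi : Function.Injective i) {c e d : ℕ} (hc : c + Module.finrank k V = Module.finrank k W)
    (he : e + Module.finrank k U = Module.finrank k V) {I : Ideal (CoordRing k W)}
    (hd : locDim (irrel k U) (I.map (pullHom (j ∘ₗ i)).toRingHom) ≤ d)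
    (h : LocDepthGE (irrel k W) (d + e + c) I) :
    LocDepthGE (irrel k V) (d + e) (I.map (pullHom j).toRingHom) := by
  obtain ⟨L, hL, hlen, hker⟩ := exists_forms hj
  obtain ⟨M, hM, hMlen, hMker⟩ := exists_forms hi
  obtain rfl : L.length = c := by omega
  obtain rfl : M.length = e := by omega
  -- The equations `M` of `U` in `V` are lifted to `W`, so that both cuts take place in the local
  -- ring of `W` and `LocDepthGE.sup_ofList` applies.
  obtain ⟨s, hs⟩ := (pullHom_surjective hj).hasRightInverse
  have hsM : ∀ x ∈ M.map s, x ∈ irrel k W := by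
    intro x hx
    obtain ⟨y, hy, rfl⟩ := List.mem_map.1 hx
    rw [comap_irrel j, Ideal.mem_comap, hs]
    exact mem_irrel_of_forms hM y hy
  have hmap : (Ideal.ofList (M.map s)).map (pullHom j).toRingHom = Ideal.ofList M := by
    rw [Ideal.map_ofList, List.map_map]
    congr 1
    exact List.map_id'' hs M
  rw [← locDepthGE_comap_iff (pullHom_surjective hj) _ _ (comap_irrel j), comap_map_pullHom hj hker]
  have h1 := LocDepthGE.sup_ofList (d := d) (I := I) L (M.map s) (mem_irrel_of_forms hL) hsM
  rw [List.length_map] at h1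
  refine h1 ?_ h
  rw [map_pullHom_comp, locDim_map_pullHom hi hMker,
    ← locDim_comap (pullHom_surjective hj) _ _ (comap_irrel j), ← hmap, ← Ideal.map_sup,
    comap_map_pullHom hj hker, sup_right_comm] at hd
  exact hd

end CoordRingLemmas

end ProjLinear

namespace ProjLinear

/-! ### Depth of cones and of affine space -/

section Cone

variable {k : Type*} [Field k]
variable {W : Type*} [AddCommGroup W] [Module k W] [FiniteDimensional k W]

/-- A cone over a Cohen-Macaulay cone is Cohen-Macaulay. -/
theorem LocDepthGE.map_pullHom_of_surjective {n c : ℕ} {I : Ideal (CoordRing k W)}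
    (h : LocDepthGE (irrel k W) n I) {V : Type*} [AddCommGroup V] [Module k V]
    [FiniteDimensional k V] {g : V →ₗ[k] W} (hg : Function.Surjective g)
    (hc : Module.finrank k W + c = Module.finrank k V) :
    LocDepthGE (irrel k V) (n + c) (I.map (pullHom g).toRingHom) := by
  induction c generalizing V with
  | zero =>
    have hinj : Function.Injective g :=
      (LinearMap.injective_iff_surjective_of_finrank_eq_finrank (by omega)).2 hg
    obtain ⟨r, hr⟩ := g.exists_rightInverse_of_surjective (LinearMap.range_eq_top.2 hg)
    have hcomap : (I.map (pullHom g).toRingHom).comap (pullHom g).toRingHom = I := by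
      rw [Ideal.comap_map_of_surjective' _ (pullHom_surjective hinj)]
      refine sup_eq_left.2 fun F hF => ?_
      have h1 : pullHom r (pullHom g F) = F := by
        rw [pullHom_pullHom, hr, pullHom_id]
        rfl
      have h2 : pullHom g F = 0 := hF
      rw [← h1, h2, map_zero]
      exact I.zero_mem
    rw [← locDepthGE_comap_iff (pullHom_surjective hinj) _ _ (comap_irrel g), hcomap]
    exact h
  | succ c ih =>
    -- One variable is split off: `V = Ker t ⊕ k v` with `g v = 0`, so `g` factors through the
    -- projection `π` along `v`, and induction handles the restriction of `g` to `Ker t`.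
    obtain ⟨v, hv, hv0⟩ : ∃ v, g v = 0 ∧ v ≠ 0 := by
      by_contra! hcon
      have := LinearMap.finrank_le_finrank_of_injective (f := g)
        (LinearMap.ker_eq_bot.1 (LinearMap.ker_eq_bot'.2 hcon))
      omega
    obtain ⟨t, ht⟩ := (LinearMap.toSpanSingleton k V v).exists_leftInverse_of_injective
      (LinearMap.ker_toSpanSingleton k hv0)
    have htv : t v = 1 := by
      have h1 := LinearMap.congr_fun ht 1
      simpa using h1
    let π : V →ₗ[k] LinearMap.ker t := (LinearMap.id - t.smulRight v).codRestrict _ fun x => by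
      simp [htv]
    have hπ : ∀ x, ((π x : LinearMap.ker t) : V) = x - t x • v := fun x => rfl
    let g' : LinearMap.ker t →ₗ[k] W := g ∘ₗ (LinearMap.ker t).subtype
    have hgg' : g = g' ∘ₗ π := by
      ext x
      change g x = g (x - t x • v)
      rw [map_sub, map_smul, hv, smul_zero, sub_zero]
    have hg' : Function.Surjective g' := by
      rw [hgg'] at hg
      exact Function.Surjective.of_comp hg
    have hfin : Module.finrank k W + c = Module.finrank k (LinearMap.ker t) := by
      have h1 := LinearMap.finrank_range_add_finrank_ker t
      have h2 : LinearMap.range t = ⊤ := LinearMap.range_eq_top.2 fun a => ⟨a • v, by simp [htv]⟩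
      rw [h2, finrank_top, Module.finrank_self] at h1
      omega
    have h3 := LocDepthGE.map_pullHom_of_section (π := π) (s := (LinearMap.ker t).subtype)
      (t := t) (v := v) (LinearMap.ext fun x => Subtype.ext (by
        rw [LinearMap.comp_apply, hπ]
        simp)) (LinearMap.ext fun x => x.2) htv (Subtype.ext (by simp [hπ, htv]))
      (fun x => by simp [hπ]) (ih hg' hfin)
    rw [← map_pullHom_comp, ← hgg'] at h3
    exact h3

-- Affine space is the cone over the zero space. Together with the dimension bound `locDim_bot_le`,
-- this makes the local ring at the origin Cohen–Macaulay, as needed for catenarity.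
variable (k W) in
theorem locDepthGE_finrank : LocDepthGE (irrel k W) (Module.finrank k W) ⊥ := by
  have h := LocDepthGE.map_pullHom_of_surjective (W := (PUnit : Type)) (k := k)
    (I := ⊥) (.zero _) (g := (0 : W →ₗ[k] (PUnit : Type))) (fun x => ⟨0, Subsingleton.elim _ _⟩)
    (c := Module.finrank k W) (by rw [Module.finrank_zero_of_subsingleton]; simp)
  rwa [zero_add, Ideal.map_bot] at h

variable (k W) in
theorem locDim_bot_le : locDim (irrel k W) ⊥ ≤ Module.finrank k W := by
  have h := locDim_le_locDim_map_add (V := (PUnit : Type)) (j := (0 : (PUnit : Type) →ₗ[k] W))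
    (Function.injective_of_subsingleton _) (c := Module.finrank k W)
    (by rw [Module.finrank_zero_of_subsingleton (M := (PUnit : Type)), add_zero]) ⊥
  rw [Ideal.map_bot] at h
  have h0 : locDim (irrel k (PUnit : Type)) ⊥ ≤ 0 := by
    refine ringKrullDim_quotient_le_zero fun q hq _ =>
      le_antisymm (IsLocalRing.le_maximalIdeal hq.ne_top) ?_
    rw [← Localization.AtPrime.map_eq_maximalIdeal, Ideal.map_le_iff_le_comap]
    refine irrel_le_of_linForm_mem fun l => ?_
    rw [Subsingleton.elim l 0, linForm_zero]
    exact Ideal.zero_mem _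
  refine h.trans ((add_le_add_left h0 _).trans ?_)
  rw [zero_add]

end Cone

/-! ### Homogeneous ideals -/

section Homogeneous

variable {k : Type*} [Field k]
variable {V : Type*} [AddCommGroup V] [Module k V]

theorem algebraMapInv_of_mem_grading {n : ℕ} (hn : n ≠ 0) {F : CoordRing k V}
    (hF : F ∈ grading k V n) : F ∈ irrel k V := by
  obtain ⟨m, rfl⟩ := Nat.exists_eq_succ_of_ne_zero hn
  rw [grading, pow_succ] at hF
  induction hF using Submodule.mul_induction_on' with
  | mem_mul_mem x _ y hy =>
    obtain ⟨l, rfl⟩ := hy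
    exact Ideal.mul_mem_left _ _ (linForm_mem_irrel l)
  | add x _ y _ hx hy => exact add_mem hx hy

theorem decompose_zero_eq (F : CoordRing k V) :
    ((DirectSum.decompose (grading k V) F 0 : grading k V 0) : CoordRing k V) =
      algebraMap k _ ((SymmetricAlgebra.algebraMapInv : CoordRing k V →ₐ[k] k) F) := by
  classical
  obtain ⟨c, hc⟩ : ∃ c, ((DirectSum.decompose (grading k V) F 0 : grading k V 0) :
      CoordRing k V) = algebraMap k _ c := by
    have h := (DirectSum.decompose (grading k V) F 0).2
    replace h : _ ∈ LinearMap.range (SymmetricAlgebra.ι k (Module.Dual k V)) ^ 0 := h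
    rw [pow_zero] at h
    obtain ⟨c, hc⟩ := Submodule.mem_one.1 h
    exact ⟨c, hc.symm⟩
  have h1 : F - algebraMap k _ c ∈ irrel k V := by
    rw [← hc]
    nth_rewrite 1 [← DirectSum.sum_support_decompose (grading k V) F]
    by_cases h0 : 0 ∈ (DirectSum.decompose (grading k V) F).support
    · rw [← Finset.add_sum_erase _ _ h0, add_sub_cancel_left]
      exact Ideal.sum_mem _ fun n hn =>
        algebraMapInv_of_mem_grading (Finset.ne_of_mem_erase hn) (SetLike.coe_mem _)
    · rw [DFinsupp.notMem_support_iff.1 h0, ZeroMemClass.coe_zero, sub_zero]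
      refine Ideal.sum_mem _ fun n hn =>
        algebraMapInv_of_mem_grading (fun h => h0 (h ▸ hn)) (SetLike.coe_mem _)
  rw [mem_irrel, map_sub, AlgHom.commutes, sub_eq_zero] at h1
  rw [h1, hc]
  rfl

theorem mem_irrelevant_iff_mem_irrel {F : CoordRing k V} :
    F ∈ HomogeneousIdeal.irrelevant (grading k V) ↔ F ∈ irrel k V := by
  rw [HomogeneousIdeal.mem_irrelevant_iff, mem_irrel, GradedRing.proj_apply, decompose_zero_eq,
    SymmetricAlgebra.algebraMap_eq_zero_iff]

theorem le_irrel_of_isHomogeneous {I : Ideal (CoordRing k V)} (hI : I.IsHomogeneous (grading k V))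
    (hne : I ≠ ⊤) : I ≤ irrel k V := by
  intro F hF
  by_contra h
  have h1 := hI 0 hF
  rw [decompose_zero_eq] at h1
  refine hne (Ideal.eq_top_of_isUnit_mem _ h1 (IsUnit.map _ ?_))
  exact isUnit_iff_ne_zero.2 h

/-- The homogeneous core of `P` is a prime between `I` and `P`, so minimality makes it equal to `P`.
-/
theorem isHomogeneous_of_mem_minimalPrimes {I P : Ideal (CoordRing k V)}
    (hI : I.IsHomogeneous (grading k V)) (hP : P ∈ I.minimalPrimes) :
    P.IsHomogeneous (grading k V) := by
  have h1 : I ≤ (P.homogeneousCore (grading k V)).toIdeal := by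
    rw [← hI.toIdeal_homogeneousCore_eq_self]
    exact Ideal.homogeneousCore_mono _ hP.1.2
  have h2 := Ideal.toIdeal_homogeneousCore_le (grading k V) P
  rw [le_antisymm (hP.2 ⟨hP.1.1.homogeneousCore, h1⟩ h2) h2]
  exact HomogeneousIdeal.isHomogeneous _

/-- Associated primes of a homogeneous ideal, with homogeneous witnesses. -/
theorem exists_isHomogeneous_isAssoc [FiniteDimensional k V] {I : Ideal (CoordRing k V)}
    (hI : I.IsHomogeneous (grading k V)) {F : CoordRing k V}
    (hF : SetLike.IsHomogeneousElem (grading k V) F) (hFI : F ∉ I) :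
    ∃ G : CoordRing k V, SetLike.IsHomogeneousElem (grading k V) G ∧ (∃ H, G = H * F) ∧ G ∉ I ∧
      ∃ Q : Ideal (CoordRing k V), Q.IsPrime ∧ Q.IsHomogeneous (grading k V) ∧
        ∀ b, b ∈ Q ↔ b * G ∈ I := by
  let C : CoordRing k V → Ideal (CoordRing k V) := fun G =>
    { carrier := {b | b * G ∈ I}
      add_mem' := fun {a b} ha hb => by
        change (a + b) * G ∈ I
        rw [add_mul]
        exact I.add_mem ha hb
      zero_mem' := by simp
      smul_mem' := fun c b hb => by
        change c * b * G ∈ I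
        rw [mul_assoc]
        exact I.mul_mem_left _ hb }
  have hC : ∀ G b, b ∈ C G ↔ b * G ∈ I := fun G b => Iff.rfl
  -- A maximal annihilator among those of homogeneous multiples of `F` outside `I`. Being
  -- homogeneous, it can be tested for primality on homogeneous elements only, and then multiplying
  -- `G` by such an element stays within the family.
  obtain ⟨Q, ⟨G, hG, hGF, hGI, rfl⟩, hmax⟩ := set_has_maximal_iff_noetherian.mpr
    (isNoetherianRing_coordRing (k := k) (V := V))
    {Q | ∃ G, SetLike.IsHomogeneousElem (grading k V) G ∧ (∃ H, G = H * F) ∧ G ∉ I ∧ Q = C G}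
    ⟨_, F, hF, ⟨1, (one_mul F).symm⟩, hFI, rfl⟩
  have hhom : (C G).IsHomogeneous (grading k V) := by
    intro n b hb
    obtain ⟨m, hm⟩ := hG
    rw [hC] at hb ⊢
    have h1 := hI (n + m) hb
    rwa [DirectSum.coe_decompose_mul_add_of_right_mem (grading k V) hm] at h1
  refine ⟨G, hG, hGF, hGI, C G, ?_, hhom, hC G⟩
  refine hhom.isPrime_of_homogeneous_mem_or_mem (fun htop => hGI ?_) fun {x y} hx hy hxy => ?_
  · simpa using (hC G 1).1 (htop ▸ Submodule.mem_top)
  · by_contra! hcon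
    obtain ⟨H, rfl⟩ := hGF
    refine hmax (C (y * (H * F))) ⟨y * (H * F), ?_, ⟨y * H, by ring⟩, hcon.2, rfl⟩
      (lt_of_le_of_ne (fun b hb => ?_) fun heq => hcon.1 ?_)
    · obtain ⟨a, ha⟩ := hy
      obtain ⟨b, hb⟩ := hG
      exact ⟨a + b, SetLike.mul_mem_graded ha hb⟩
    · rw [hC] at hb ⊢
      have h1 := I.mul_mem_left y hb
      rwa [mul_left_comm] at h1
    · rw [heq, hC, ← mul_assoc]
      exact hxy

theorem isHomogeneous_le_of_forall {I J : Ideal (CoordRing k V)}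
    (hI : I.IsHomogeneous (grading k V))
    (h : ∀ F, SetLike.IsHomogeneousElem (grading k V) F → F ∈ I → F ∈ J) : I ≤ J := by
  classical
  intro F hF
  rw [← DirectSum.sum_support_decompose (grading k V) F]
  exact Ideal.sum_mem _ fun n _ => h _ ⟨n, SetLike.coe_mem _⟩ (hI n hF)

end Homogeneous

end ProjLinear

namespace ProjLinear

/-! ### The dimension of a closed subset of projective space -/

section ProjDim

open Topology

variable {k : Type*} [Field k]
variable {V : Type*} [AddCommGroup V] [Module k V]

instance t0Space_projectiveSpectrum : T0Space (ProjectiveSpectrum (grading k V)) where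
  t0 x y h := le_antisymm
    ((ProjectiveSpectrum.le_iff_mem_closure _ x y).2 h.specializes.mem_closure)
    ((ProjectiveSpectrum.le_iff_mem_closure _ y x).2 h.specializes'.mem_closure)

instance quasiSober_projectiveSpectrum : QuasiSober (ProjectiveSpectrum (grading k V)) :=
  inferInstanceAs (QuasiSober (AlgebraicGeometry.Proj (grading k V)))

theorem specializes_iff_le {x y : ProjectiveSpectrum (grading k V)} : x ⤳ y ↔ x ≤ y := by
  rw [specializes_iff_mem_closure, ProjectiveSpectrum.le_iff_mem_closure]

/-- In a sober T0 space irreducible closed sets correspond to points. Specialization is inclusion of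
primes, which reverses inclusion of closures, hence the order dual. -/
theorem topologicalKrullDim_eq_of_range {T : Type*} [TopologicalSpace T]
    {e : T → ProjectiveSpectrum (grading k V)} (he : IsClosedEmbedding e)
    {Z : Set (ProjectiveSpectrum (grading k V))} (hZ : Set.range e = Z) :
    topologicalKrullDim T = Order.krullDim Z := by
  subst hZ
  have := he.quasiSober
  have := he.isEmbedding.t0Space
  let _ := specializationOrder T
  rw [topologicalKrullDim, Order.krullDim_eq_of_orderIso irreducibleSetEquivPoints,
    ← Order.krullDim_orderDual]
  refine Order.krullDim_eq_of_orderIso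
    { toEquiv := OrderDual.ofDual.trans (Equiv.ofInjective e he.injective)
      map_rel_iff' := fun {a b} => ?_ }
  change e (OrderDual.ofDual a) ≤ e (OrderDual.ofDual b) ↔ OrderDual.ofDual a ⤳ OrderDual.ofDual b
  rw [← specializes_iff_le, he.isInducing.specializes_iff]

theorem irrel_le_iff {I : HomogeneousIdeal (grading k V)} :
    irrel k V ≤ I.toIdeal ↔ HomogeneousIdeal.irrelevant (grading k V) ≤ I := by
  constructor
  · exact fun h F hF => h (mem_irrelevant_iff_mem_irrel.1 hF)
  · exact fun h F hF => h (mem_irrelevant_iff_mem_irrel.2 hF)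

theorem lt_irrel (x : ProjectiveSpectrum (grading k V)) :
    x.asHomogeneousIdeal.toIdeal < irrel k V :=
  lt_of_le_not_ge (le_irrel_of_isHomogeneous x.asHomogeneousIdeal.isHomogeneous x.isPrime.ne_top)
    fun h => x.not_irrelevant_le (irrel_le_iff.1 h)

/-- The point of projective space given by a relevant homogeneous prime ideal. -/
def pointOf (P : Ideal (CoordRing k V)) (hP : P.IsPrime) (hhom : P.IsHomogeneous (grading k V))
    (hrel : ¬ irrel k V ≤ P) : ProjectiveSpectrum (grading k V) where
  asHomogeneousIdeal := ⟨P, hhom⟩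
  isPrime := hP
  not_irrelevant_le := fun h => hrel (irrel_le_iff.2 h)

theorem mem_zeroLocus_ideal {I : Ideal (CoordRing k V)} {x : ProjectiveSpectrum (grading k V)} :
    x ∈ ProjectiveSpectrum.zeroLocus (grading k V) (I : Set (CoordRing k V)) ↔
      I ≤ x.asHomogeneousIdeal.toIdeal :=
  Iff.rfl

/-- The irrelevant ideal lies strictly above every point and prolongs the chain at the top; this is
the extra one. -/
theorem length_add_one_le_locDim (l : LTSeries (ProjectiveSpectrum (grading k V))) :
    ((l.length + 1 : ℕ) : WithBot ℕ∞) ≤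
      locDim (irrel k V) l.head.asHomogeneousIdeal.toIdeal := by
  induction l using RelSeries.inductionOn with
  | singleton x =>
    have h := (add_le_add_left (locDim_nonneg (le_refl (irrel k V))) 1).trans
      (locDim_succ_le_of_lt (lt_irrel x) le_rfl)
    simpa using h
  | cons l x hx ih =>
    have h := (add_le_add_left ih 1).trans
      (locDim_succ_le_of_lt (P := x.asHomogeneousIdeal.toIdeal) hx (lt_irrel l.head).le)
    rw [RelSeries.head_cons, RelSeries.cons_length]
    exact_mod_cast h

/-- A relevant prime misses some linear form, whose powers can be cancelled. Saturation thus leaves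
the zero locus unchanged, and dimensions may be computed from unsaturated generators. -/
theorem saturation_toIdeal_le {I : HomogeneousIdeal (grading k V)} {P : Ideal (CoordRing k V)}
    (hP : P.IsPrime) (hrel : ¬ irrel k V ≤ P) (h : I.toIdeal ≤ P) :
    (saturation I).toIdeal ≤ P := by
  intro F hF
  obtain ⟨l, hl⟩ : ∃ l, linForm k V l ∉ P := by
    by_contra! hcon
    exact hrel (irrel_le_of_linForm_mem hcon)
  obtain ⟨n, hn⟩ := mem_saturation.1 hF l
  exact (hP.mem_or_mem (h hn)).resolve_left fun h1 => hl (hP.mem_of_pow_mem n h1)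

theorem le_saturation (I : HomogeneousIdeal (grading k V)) : I ≤ saturation I :=
  fun F hF => mem_saturation.2 fun l => ⟨0, by simpa using hF⟩

theorem support_ofIdeal (I : HomogeneousIdeal (grading k V)) :
    (ofIdeal I).support =
      ProjectiveSpectrum.zeroLocus (grading k V) (I.toIdeal : Set (CoordRing k V)) := by
  ext x
  constructor
  · exact fun h => (le_saturation I).trans h
  · exact fun h => saturation_toIdeal_le x.isPrime (lt_irrel x).not_ge h

variable [FiniteDimensional k V]

/-- Induction by a hyperplane section missing the generic point of every component: it lowers the
projective dimension by at least one and the dimension at the vertex by at most one. -/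
theorem locDim_le_of_krullDim_lt [Infinite k] (e : ℕ) {J : Ideal (CoordRing k V)}
    (hJ : J.IsHomogeneous (grading k V))
    (h : ¬ (e : WithBot ℕ∞) ≤ Order.krullDim
      (ProjectiveSpectrum.zeroLocus (grading k V) (J : Set (CoordRing k V)))) :
    locDim (irrel k V) J ≤ e := by
  induction e generalizing J with
  | zero =>
    have hempty : ∀ x : ProjectiveSpectrum (grading k V),
        ¬ J ≤ x.asHomogeneousIdeal.toIdeal := by
      intro x hx
      have : Nonempty (ProjectiveSpectrum.zeroLocus (grading k V) (J : Set (CoordRing k V))) :=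
        ⟨x, hx⟩
      exact h (by exact_mod_cast Order.krullDim_nonneg)
    refine (ringKrullDim_quotient_le_zero fun q hq hle => ?_).trans (by simp)
    rw [Ideal.map_le_iff_le_comap] at hle
    refine le_antisymm (IsLocalRing.le_maximalIdeal hq.ne_top) ?_
    rw [← Localization.AtPrime.map_eq_maximalIdeal, Ideal.map_le_iff_le_comap]
    by_contra hcon
    -- The homogeneous core of `q` is a prime containing `J`. As `J` has no points it must be
    -- irrelevant, so `q` is maximal.
    have hq' : (q.comap (algebraMap (CoordRing k V)
      (Localization.AtPrime (irrel k V)))).IsPrime := inferInstance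
    have hcore := Ideal.toIdeal_homogeneousCore_le (grading k V)
      (q.comap (algebraMap (CoordRing k V) (Localization.AtPrime (irrel k V))))
    refine hempty (pointOf _ hq'.homogeneousCore (HomogeneousIdeal.isHomogeneous _)
      fun h1 => hcon (h1.trans hcore)) ?_
    have h2 := Ideal.homogeneousCore_mono (grading k V) hle
    have h3 := hJ.toIdeal_homogeneousCore_eq_self
    exact h3.symm.le.trans h2
  | succ e ih =>
    let S : Set (Ideal (CoordRing k V)) := {P | P ∈ J.minimalPrimes ∧ ¬ irrel k V ≤ P}
    have hS : S.Finite := (Ideal.finite_minimalPrimes_of_isNoetherianRing _ J).subset fun P hP => hP.1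
    let lin : Ideal (CoordRing k V) → Submodule k (Module.Dual k V) := fun P =>
      (P.restrictScalars k).comap (SymmetricAlgebra.ι k (Module.Dual k V))
    -- Over an infinite field, finitely many proper subspaces do not cover the space of linear
    -- forms. The forms lying in a relevant prime are a proper subspace.
    have hcover : ⋃ p ∈ (hS.image lin).toFinset, (p : Set (Module.Dual k V)) ≠ Set.univ := by
      refine Subspace.biUnion_ne_univ_of_top_notMem fun htop => ?_
      obtain ⟨P, hP, hPtop⟩ := (hS.image lin).mem_toFinset.1 htop
      refine hP.2 (irrel_le_of_linForm_mem fun l => ?_)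
      have : l ∈ lin P := hPtop ▸ Submodule.mem_top
      exact this
    obtain ⟨l, hl⟩ := (Set.ne_univ_iff_exists_notMem _).1 hcover
    have hl' : ∀ P ∈ S, linForm k V l ∉ P := by
      intro P hP hlP
      refine hl (Set.mem_biUnion (x := lin P) ((hS.image lin).mem_toFinset.2 ⟨P, hP, rfl⟩) hlP)
    have hJ' : (J ⊔ Ideal.ofList [linForm k V l]).IsHomogeneous (grading k V) := by
      refine hJ.sup ?_
      rw [Ideal.ofList_singleton]
      refine Ideal.homogeneous_span _ _ ?_
      rintro x rfl
      exact ⟨1, linForm_mem k V l⟩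
    have h1 := locDim_le_add_length J (p := irrel k V) (L := [linForm k V l])
      (by simpa using linForm_mem_irrel l)
    refine h1.trans ((add_le_add_left (ih hJ' fun hcon => h ?_) _).trans (by simp))
    rw [Order.le_krullDim_iff] at hcon ⊢
    obtain ⟨s, hs⟩ := hcon
    have hhead : J ⊔ Ideal.ofList [linForm k V l] ≤ s.head.1.asHomogeneousIdeal.toIdeal :=
      s.head.2
    have hprime := s.head.1.isPrime
    -- A chain in the hyperplane section is prolonged below by a minimal prime `P` of `J`; the step
    -- is strict because the section form lies in the head and not in `P`.
    obtain ⟨P, hP, hPs⟩ := Ideal.exists_minimalPrimes_le (le_sup_left.trans hhead)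
    have hrel : ¬ irrel k V ≤ P := fun h2 => (lt_irrel s.head.1).not_ge (h2.trans hPs)
    let x := pointOf P hP.1.1 (isHomogeneous_of_mem_minimalPrimes hJ hP) hrel
    have hmem : ∀ i, (s i).1 ∈
        ProjectiveSpectrum.zeroLocus (grading k V) (J : Set (CoordRing k V)) :=
      fun i => (le_sup_left : J ≤ _).trans (s i).2
    let s' : LTSeries (ProjectiveSpectrum.zeroLocus (grading k V) (J : Set (CoordRing k V))) :=
      ⟨s.length, fun i => ⟨(s i).1, hmem i⟩, fun i => s.step i⟩
    have hlt : (⟨x, hP.1.2⟩ : ProjectiveSpectrum.zeroLocus (grading k V)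
        (J : Set (CoordRing k V))) < s'.head := by
      refine lt_of_le_not_ge hPs fun hge => hl' P ⟨hP, hrel⟩ ?_
      have h3 : s.head.1.asHomogeneousIdeal.toIdeal ≤ P := hge
      exact h3 (hhead (Ideal.mem_sup_right (Ideal.subset_span (by simp))))
    exact ⟨s'.cons _ hlt, by rw [RelSeries.cons_length, ← hs]⟩

theorem krullDim_zeroLocus_add_one [Infinite k] {J : Ideal (CoordRing k V)}
    (hJ : J.IsHomogeneous (grading k V))
    (hne : (ProjectiveSpectrum.zeroLocus (grading k V) (J : Set (CoordRing k V))).Nonempty) :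
    ∃ d : ℕ, Order.krullDim
        (ProjectiveSpectrum.zeroLocus (grading k V) (J : Set (CoordRing k V))) = d ∧
      locDim (irrel k V) J = ((d + 1 : ℕ) : WithBot ℕ∞) := by
  have := hne.to_subtype
  have key : ∀ n : ℕ, (n : WithBot ℕ∞) ≤ Order.krullDim
      (ProjectiveSpectrum.zeroLocus (grading k V) (J : Set (CoordRing k V))) →
      ((n + 1 : ℕ) : WithBot ℕ∞) ≤ locDim (irrel k V) J := by
    intro n hn
    obtain ⟨s, rfl⟩ := Order.le_krullDim_iff.1 hn
    let s' : LTSeries (ProjectiveSpectrum (grading k V)) :=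
      ⟨s.length, fun i => (s i).1, fun i => s.step i⟩
    exact (length_add_one_le_locDim s').trans (locDim_anti s.head.2)
  have hfin : locDim (irrel k V) J ≤ Module.finrank k V :=
    (locDim_anti bot_le).trans (locDim_bot_le k V)
  obtain ⟨d, hd⟩ : ∃ d : ℕ, Order.krullDim
      (ProjectiveSpectrum.zeroLocus (grading k V) (J : Set (CoordRing k V))) = d := by
    have h0 : 0 ≤ Order.krullDim
      (ProjectiveSpectrum.zeroLocus (grading k V) (J : Set (CoordRing k V))) :=
      Order.krullDim_nonneg
    generalize Order.krullDim
      (ProjectiveSpectrum.zeroLocus (grading k V) (J : Set (CoordRing k V))) = D at key h0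
    induction D with
    | bot => simp at h0
    | coe D =>
      induction D with
      | top =>
        have h1 := (key (Module.finrank k V) (by exact_mod_cast le_top)).trans hfin
        have h2 : Module.finrank k V + 1 ≤ Module.finrank k V := by exact_mod_cast h1
        omega
      | coe D => exact ⟨D, rfl⟩
  refine ⟨d, hd, le_antisymm (locDim_le_of_krullDim_lt (d + 1) hJ ?_) (key d hd.ge)⟩
  rw [hd]
  intro h
  have h2 : d + 1 ≤ d := by exact_mod_cast h
  omega

/-- Only the zero locus of `J` matters, so that `J` may be the unsaturated ideal of a linear
section. -/
theorem exists_dim_eq [Infinite k] (X : ProjSubscheme k V) {J : Ideal (CoordRing k V)}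
    (hJ : J.IsHomogeneous (grading k V))
    (hX : X.support = ProjectiveSpectrum.zeroLocus (grading k V) (J : Set (CoordRing k V)))
    (hne : X.support.Nonempty) :
    ∃ d : ℕ, X.dim = d ∧ locDim (irrel k V) J = ((d + 1 : ℕ) : WithBot ℕ∞) := by
  obtain ⟨d, hd, hd'⟩ := krullDim_zeroLocus_add_one hJ (hX ▸ hne)
  refine ⟨d, ?_, hd'⟩
  have hcl : IsClosed X.support := ProjectiveSpectrum.isClosed_zeroLocus _ _
  rw [ProjSubscheme.dim, topologicalKrullDim_eq_of_range hcl.isClosedEmbedding_subtypeVal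
    Subtype.range_coe, hX]
  exact hd

/-- On a pure-dimensional subscheme all minimal primes have the same dimension. -/
theorem locDim_eq_of_isPureDimensional [Infinite k] {X : ProjSubscheme k V}
    (hX : X.IsPureDimensional) {x : ProjectiveSpectrum (grading k V)} (hx : x ∈ X.support)
    (hmin : ∀ y ∈ X.support, y ≤ x → y = x) {d : ℕ} (hd : X.dim = d) :
    locDim (irrel k V) x.asHomogeneousIdeal.toIdeal = ((d + 1 : ℕ) : WithBot ℕ∞) := by
  have hcl : IsClosed X.support := ProjectiveSpectrum.isClosed_zeroLocus _ _
  have hce := hcl.isClosedEmbedding_subtypeVal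
  have hqs := hce.quasiSober
  let x' : X.support := ⟨x, hx⟩
  have hZ : closure {x'} ∈ irreducibleComponents X.support := by
    refine ⟨isIrreducible_singleton.closure, fun T hT hle => ?_⟩
    have hgen := hT.isGenericPoint_genericPoint_closure
    have h1 : hT.genericPoint ⤳ x' := by
      rw [specializes_iff_mem_closure, hgen.def]
      exact subset_closure (hle (subset_closure rfl))
    have h2 : hT.genericPoint = x' := by
      refine Subtype.ext (hmin _ hT.genericPoint.2 ?_)
      rw [← specializes_iff_le]
      exact hce.isInducing.specializes_iff.2 h1
    intro t ht
    rw [← h2, hgen.def]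
    exact subset_closure ht
  have hdim := hX _ hZ
  have hce' : IsClosedEmbedding (fun z : closure {x'} => (z : X.support).1) :=
    hce.comp isClosed_closure.isClosedEmbedding_subtypeVal
  have hrange : Set.range (fun z : closure {x'} => (z : X.support).1) =
      ProjectiveSpectrum.zeroLocus (grading k V)
        (x.asHomogeneousIdeal.toIdeal : Set (CoordRing k V)) := by
    ext y
    constructor
    · rintro ⟨z, rfl⟩
      have h1 : x' ⤳ z.1 := specializes_iff_mem_closure.2 z.2
      exact specializes_iff_le.1 (hce.isInducing.specializes_iff.2 h1)
    · intro hy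
      have hy' : y ∈ X.support := Set.Subset.trans hx hy
      have h1 : x' ⤳ ⟨y, hy'⟩ := hce.isInducing.specializes_iff.1 (specializes_iff_le.2 hy)
      exact ⟨⟨⟨y, hy'⟩, specializes_iff_mem_closure.1 h1⟩, rfl⟩
  rw [topologicalKrullDim_eq_of_range hce' hrange, hd] at hdim
  obtain ⟨d', hd', hd''⟩ := krullDim_zeroLocus_add_one
    (J := x.asHomogeneousIdeal.toIdeal) x.asHomogeneousIdeal.isHomogeneous ⟨x, mem_zeroLocus_ideal.2 le_rfl⟩
  rw [hdim] at hd'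
  have : d = d' := by exact_mod_cast hd'
  rw [hd'', this]

end ProjDim

end ProjLinear

namespace ProjLinear

/-! ### Local rings of projective space -/

section Stalk

open IsLocalRing ProjSubscheme

variable {k : Type*} [Field k]
variable {V : Type*} [AddCommGroup V] [Module k V]

/-- The ideal of fractions of degree zero in the extension of `I` to the localization at `p`. -/
noncomputable def stalkIdealOf (I : Ideal (CoordRing k V))
    (p : ProjectiveSpectrum (grading k V)) : Ideal (ambientStalk p) :=
  (I.map (algebraMap (CoordRing k V)
      (Localization.AtPrime p.asHomogeneousIdeal.toIdeal))).comap
    (algebraMap (ambientStalk p) (Localization.AtPrime p.asHomogeneousIdeal.toIdeal))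

variable {p : ProjectiveSpectrum (grading k V)} {l : Module.Dual k V}

/-- Dehomogenization with respect to a linear form `l`, as a map to the localization. -/
noncomputable def dehomVal (hl : linForm k V l ∉ p.asHomogeneousIdeal.toIdeal) :
    CoordRing k V →ₐ[k] Localization.AtPrime p.asHomogeneousIdeal.toIdeal :=
  SymmetricAlgebra.lift
    ((LinearMap.mulRight k (IsLocalization.mk' (Localization.AtPrime p.asHomogeneousIdeal.toIdeal)
      1 (⟨linForm k V l, hl⟩ : p.asHomogeneousIdeal.toIdeal.primeCompl))) ∘ₗ
      (IsScalarTower.toAlgHom k (CoordRing k V)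
        (Localization.AtPrime p.asHomogeneousIdeal.toIdeal)).toLinearMap ∘ₗ
      SymmetricAlgebra.ι k (Module.Dual k V))

theorem dehomVal_linForm (hl : linForm k V l ∉ p.asHomogeneousIdeal.toIdeal)
    (l' : Module.Dual k V) : dehomVal hl (linForm k V l') =
      IsLocalization.mk' (Localization.AtPrime p.asHomogeneousIdeal.toIdeal) (linForm k V l')
        (⟨linForm k V l, hl⟩ : p.asHomogeneousIdeal.toIdeal.primeCompl) := by
  refine (SymmetricAlgebra.lift_ι_apply _ _).trans ?_
  change algebraMap (CoordRing k V) (Localization.AtPrime p.asHomogeneousIdeal.toIdeal)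
    (linForm k V l') * _ = _
  rw [IsLocalization.mul_mk'_eq_mk'_of_mul, mul_one]

theorem dehomVal_of_mem (hl : linForm k V l ∉ p.asHomogeneousIdeal.toIdeal) {n : ℕ}
    {F : CoordRing k V} (hF : F ∈ grading k V n) : dehomVal hl F =
      IsLocalization.mk' (Localization.AtPrime p.asHomogeneousIdeal.toIdeal) F
        ((⟨linForm k V l, hl⟩ : p.asHomogeneousIdeal.toIdeal.primeCompl) ^ n) := by
  induction hF using Submodule.pow_induction_on_left' with
  | algebraMap r =>
    rw [AlgHom.commutes, pow_zero, IsLocalization.mk'_one]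
    rfl
  | add x y n hx hy ihx ihy => 
    rw [map_add, ihx, ihy, IsLocalization.mk'_eq_mul_mk'_one (x + y), map_add, add_mul,
      ← IsLocalization.mk'_eq_mul_mk'_one, ← IsLocalization.mk'_eq_mul_mk'_one]
  | mem_mul m hm n x hx ih =>
    obtain ⟨l', rfl⟩ := hm
    rw [map_mul, ih, pow_succ', IsLocalization.mk'_mul]
    congr 1
    exact dehomVal_linForm hl l'

theorem exists_val_eq_dehomVal (hl : linForm k V l ∉ p.asHomogeneousIdeal.toIdeal)
    (F : CoordRing k V) : ∃ r : ambientStalk p, r.val = dehomVal hl F := by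
  classical
  rw [← DirectSum.sum_support_decompose (grading k V) F, map_sum]
  have h : ∀ n, ∃ r : ambientStalk p,
      r.val = dehomVal hl (DirectSum.decompose (grading k V) F n : CoordRing k V) := by
    intro n
    rw [dehomVal_of_mem hl (SetLike.coe_mem _)]
    refine ⟨HomogeneousLocalization.mk ⟨n, DirectSum.decompose (grading k V) F n,
      ⟨linForm k V l ^ n, ?_⟩, ?_⟩, ?_⟩
    · simpa using SetLike.pow_mem_graded n (linForm_mem k V l)
    · exact ((⟨linForm k V l, hl⟩ : p.asHomogeneousIdeal.toIdeal.primeCompl) ^ n).2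
    · rw [HomogeneousLocalization.val_mk, Localization.mk_eq_mk']
      rfl
  choose r hr using h
  refine ⟨∑ n ∈ (DirectSum.decompose (grading k V) F).support, r n, ?_⟩
  simp_rw [← hr]
  exact map_sum (algebraMap (ambientStalk p) _) _ _

/-- Dehomogenization with respect to a linear form `l` not vanishing at `p`, as a map to the local
ring at `p`: it sends a form `F` of degree `n` to `F / l ^ n`. -/
noncomputable def dehom (hl : linForm k V l ∉ p.asHomogeneousIdeal.toIdeal) :
    CoordRing k V →+* ambientStalk p where
  toFun F := (exists_val_eq_dehomVal hl F).choose
  map_one' := HomogeneousLocalization.val_injective _ (by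
    rw [(exists_val_eq_dehomVal hl 1).choose_spec, map_one, HomogeneousLocalization.val_one])
  map_mul' F G := HomogeneousLocalization.val_injective _ (by
    rw [HomogeneousLocalization.val_mul, (exists_val_eq_dehomVal hl _).choose_spec,
      (exists_val_eq_dehomVal hl _).choose_spec, (exists_val_eq_dehomVal hl _).choose_spec,
      map_mul])
  map_zero' := HomogeneousLocalization.val_injective _ (by
    rw [(exists_val_eq_dehomVal hl 0).choose_spec, map_zero, HomogeneousLocalization.val_zero])
  map_add' F G := HomogeneousLocalization.val_injective _ (by
    rw [HomogeneousLocalization.val_add, (exists_val_eq_dehomVal hl _).choose_spec,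
      (exists_val_eq_dehomVal hl _).choose_spec, (exists_val_eq_dehomVal hl _).choose_spec,
      map_add])

variable (hl : linForm k V l ∉ p.asHomogeneousIdeal.toIdeal)

theorem val_dehom (F : CoordRing k V) : (dehom hl F).val = dehomVal hl F :=
  (exists_val_eq_dehomVal hl F).choose_spec

theorem dehom_linForm_self : dehom hl (linForm k V l) = 1 := by
  apply HomogeneousLocalization.val_injective
  rw [val_dehom, dehomVal_linForm, HomogeneousLocalization.val_one]
  exact IsLocalization.mk'_self' (Localization.AtPrime p.asHomogeneousIdeal.toIdeal)

theorem isUnit_dehom {F : CoordRing k V} (hF : SetLike.IsHomogeneousElem (grading k V) F) :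
    IsUnit (dehom hl F) ↔ F ∉ p.asHomogeneousIdeal.toIdeal := by
  obtain ⟨n, hn⟩ := hF
  rw [← HomogeneousLocalization.isUnit_iff_isUnit_val, val_dehom, dehomVal_of_mem hl hn,
    IsLocalization.AtPrime.isUnit_mk'_iff (Localization.AtPrime p.asHomogeneousIdeal.toIdeal)
      p.asHomogeneousIdeal.toIdeal]
  rfl

theorem dehom_mem_maximalIdeal {F : CoordRing k V}
    (hF : SetLike.IsHomogeneousElem (grading k V) F) :
    dehom hl F ∈ maximalIdeal (ambientStalk p) ↔ F ∈ p.asHomogeneousIdeal.toIdeal := by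
  rw [mem_maximalIdeal, mem_nonunits_iff, isUnit_dehom hl hF, not_not]

/-- The identity `a / s = (a / lⁿ) / (s / lⁿ)`: up to units, the local ring consists of
dehomogenized forms, and its ideals are determined by the forms they contain. -/
theorem exists_mul_dehom_eq (r : ambientStalk p) : ∃ n, ∃ a ∈ grading k V n,
    ∃ s ∈ grading k V n, ∃ hs : s ∉ p.asHomogeneousIdeal.toIdeal,
      r * dehom hl s = dehom hl a ∧ r.val = IsLocalization.mk' _ a
        (⟨s, hs⟩ : p.asHomogeneousIdeal.toIdeal.primeCompl) := by
  have hr : r.val = IsLocalization.mk' _ r.num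
      (⟨r.den, r.den_mem⟩ : p.asHomogeneousIdeal.toIdeal.primeCompl) := by
    rw [r.eq_num_div_den, Localization.mk_eq_mk']
  refine ⟨r.deg, r.num, r.num_mem_deg, r.den, r.den_mem_deg, r.den_mem, ?_, hr⟩
  apply HomogeneousLocalization.val_injective
  rw [HomogeneousLocalization.val_mul, val_dehom, val_dehom, dehomVal_of_mem hl r.num_mem_deg,
    dehomVal_of_mem hl r.den_mem_deg, hr, ← IsLocalization.mk'_mul]
  rw [mul_comm (⟨r.den, r.den_mem⟩ : p.asHomogeneousIdeal.toIdeal.primeCompl)]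
  exact IsLocalization.mk'_cancel (M := p.asHomogeneousIdeal.toIdeal.primeCompl)
    (S := Localization.AtPrime p.asHomogeneousIdeal.toIdeal) _ _ _

end Stalk

end ProjLinear

namespace ProjLinear

/-! ### Ideals in the local rings of projective space; comparison at a point -/

section StalkIdeal

open IsLocalRing ProjSubscheme

variable {k : Type*} [Field k]
variable {V : Type*} [AddCommGroup V] [Module k V]
variable {p : ProjectiveSpectrum (grading k V)} {l : Module.Dual k V}

theorem exists_linForm_notMem (p : ProjectiveSpectrum (grading k V)) :
    ∃ l, linForm k V l ∉ p.asHomogeneousIdeal.toIdeal := by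
  by_contra! hcon
  exact (lt_irrel p).not_ge (irrel_le_of_linForm_mem hcon)

theorem stalkIdealOf_mono {I J : Ideal (CoordRing k V)} (h : I ≤ J) :
    stalkIdealOf I p ≤ stalkIdealOf J p :=
  Ideal.comap_mono (Ideal.map_mono h)

theorem stalkIdealOf_isPrime {P : Ideal (CoordRing k V)} (hP : P.IsPrime)
    (hle : P ≤ p.asHomogeneousIdeal.toIdeal) : (stalkIdealOf P p).IsPrime := by
  have := IsLocalization.isPrime_of_isPrime_disjoint p.asHomogeneousIdeal.toIdeal.primeCompl
    (Localization.AtPrime p.asHomogeneousIdeal.toIdeal) P hP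
    (Set.disjoint_left.2 fun x hx hxP => hx (hle hxP))
  exact Ideal.comap_isPrime _ _

variable (hl : linForm k V l ∉ p.asHomogeneousIdeal.toIdeal)

theorem dehom_mem_stalkIdealOf_iff {F : CoordRing k V}
    (hF : SetLike.IsHomogeneousElem (grading k V) F) {I : Ideal (CoordRing k V)} :
    dehom hl F ∈ stalkIdealOf I p ↔ ∃ s ∉ p.asHomogeneousIdeal.toIdeal, s * F ∈ I := by
  obtain ⟨n, hn⟩ := hF
  change (dehom hl F).val ∈ I.map _ ↔ _
  rw [val_dehom, dehomVal_of_mem hl hn,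
    IsLocalization.mk'_mem_map_algebraMap_iff p.asHomogeneousIdeal.toIdeal.primeCompl]
  rfl

theorem exists_isHomogeneous_mul_mem {F s : CoordRing k V}
    (hF : SetLike.IsHomogeneousElem (grading k V) F) {I : Ideal (CoordRing k V)}
    (hI : I.IsHomogeneous (grading k V)) (hs : s ∉ p.asHomogeneousIdeal.toIdeal)
    (hsF : s * F ∈ I) : ∃ t ∉ p.asHomogeneousIdeal.toIdeal,
      SetLike.IsHomogeneousElem (grading k V) t ∧ t * F ∈ I := by
  classical
  obtain ⟨n, hn⟩ := hF
  obtain ⟨i, hi⟩ : ∃ i, (DirectSum.decompose (grading k V) s i : CoordRing k V) ∉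
      p.asHomogeneousIdeal.toIdeal := by
    by_contra! hcon
    refine hs ?_
    rw [← DirectSum.sum_support_decompose (grading k V) s]
    exact Ideal.sum_mem _ fun i _ => hcon i
  refine ⟨_, hi, ⟨i, SetLike.coe_mem _⟩, ?_⟩
  rw [← DirectSum.coe_decompose_mul_add_of_right_mem (grading k V) hn]
  exact hI _ hsF

theorem dehom_mem_stalkIdealOf_of_mem {F : CoordRing k V} {I : Ideal (CoordRing k V)}
    (hI : I.IsHomogeneous (grading k V)) (hF : F ∈ I) : dehom hl F ∈ stalkIdealOf I p := by
  refine isHomogeneous_le_of_forall (J := (stalkIdealOf I p).comap (dehom hl)) hI ?_ hF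
  intro F hom hF
  exact (dehom_mem_stalkIdealOf_iff hl hom).2
    ⟨1, (Ideal.ne_top_iff_one _).1 p.isPrime.ne_top, by rwa [one_mul]⟩

theorem dehom_mem_stalkIdealOf_prime_iff {P : Ideal (CoordRing k V)} (hP : P.IsPrime)
    (hle : P ≤ p.asHomogeneousIdeal.toIdeal) {F : CoordRing k V}
    (hF : SetLike.IsHomogeneousElem (grading k V) F) :
    dehom hl F ∈ stalkIdealOf P p ↔ F ∈ P := by
  rw [dehom_mem_stalkIdealOf_iff hl hF]
  constructor
  · rintro ⟨s, hs, h⟩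
    exact (hP.mem_or_mem h).resolve_left fun h => hs (hle h)
  · exact fun h => ⟨1, (Ideal.ne_top_iff_one _).1 p.isPrime.ne_top, by rwa [one_mul]⟩

theorem exists_dehom_mem_iff (r : ambientStalk p) : ∃ a,
    SetLike.IsHomogeneousElem (grading k V) a ∧
      ∀ J : Ideal (ambientStalk p), dehom hl a ∈ J ↔ r ∈ J := by
  obtain ⟨n, a, ha, s, hs, hsp, h, -⟩ := exists_mul_dehom_eq hl r
  refine ⟨a, ⟨n, ha⟩, fun J => ?_⟩
  rw [← h]
  exact J.mul_unit_mem_iff_mem ((isUnit_dehom hl ⟨n, hs⟩).2 hsp)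

theorem le_of_dehom {J J' : Ideal (ambientStalk p)}
    (h : ∀ a, SetLike.IsHomogeneousElem (grading k V) a → dehom hl a ∈ J → dehom hl a ∈ J') :
    J ≤ J' := by
  intro r hr
  obtain ⟨a, ha, hiff⟩ := exists_dehom_mem_iff hl r
  exact (hiff J').1 (h a ha ((hiff J).2 hr))

theorem le_of_maximalIdeal_le {P : Ideal (CoordRing k V)} (hP : P.IsPrime)
    (hle : P ≤ p.asHomogeneousIdeal.toIdeal)
    (h : maximalIdeal (ambientStalk p) ≤ stalkIdealOf P p) :
    p.asHomogeneousIdeal.toIdeal ≤ P := by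
  obtain ⟨l, hl⟩ := exists_linForm_notMem p
  refine isHomogeneous_le_of_forall p.asHomogeneousIdeal.isHomogeneous fun F hF hFp => ?_
  rw [← dehom_mem_stalkIdealOf_prime_iff hl hP hle hF]
  exact h ((dehom_mem_maximalIdeal hl hF).2 hFp)

theorem stalkIdealOf_le_maximalIdeal {I : Ideal (CoordRing k V)}
    (hle : I ≤ p.asHomogeneousIdeal.toIdeal) :
    stalkIdealOf I p ≤ maximalIdeal (ambientStalk p) :=
  (stalkIdealOf_mono hle).trans (le_maximalIdeal (stalkIdealOf_isPrime p.isPrime le_rfl).ne_top)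

/-- Every ideal is generated by dehomogenized forms, so it is the extension of its contraction to
the Noetherian coordinate ring. -/
instance isNoetherianRing_ambientStalk [FiniteDimensional k V] : IsNoetherianRing (ambientStalk p) := by
  obtain ⟨l, hl⟩ := exists_linForm_notMem p
  have : IsNoetherianRing (CoordRing k V) := isNoetherianRing_coordRing
  refine isNoetherianRing_iff_ideal_fg _ |>.2 fun J => ?_
  have h : (J.comap (dehom hl)).map (dehom hl) = J :=
    le_antisymm Ideal.map_comap_le
      (le_of_dehom hl fun a _ ha => Ideal.mem_map_of_mem _ (Ideal.mem_comap.2 ha))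
  rw [← h]
  exact ((isNoetherianRing_iff_ideal_fg _).1 this _).map _

theorem exists_depthGE_stalkIdealOf {X : ProjSubscheme k V} (hX : X.IsCohenMacaulay)
    (hp : p ∈ X.support) : ∃ n : ℕ,
      DepthGE (maximalIdeal (ambientStalk p)) n (stalkIdealOf X.ideal.toIdeal p) ∧
        ringKrullDim (ambientStalk p ⧸ stalkIdealOf X.ideal.toIdeal p) = n := by
  have hCM : IsCohenMacaulayLocal (ambientStalk p ⧸ stalkIdealOf X.ideal.toIdeal p) := hX p hp
  obtain ⟨-, rs, hrs, hdim⟩ := hCM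
  have hle : stalkIdealOf X.ideal.toIdeal p ≤ maximalIdeal (ambientStalk p) :=
    stalkIdealOf_le_maximalIdeal hp
  have : Nontrivial (ambientStalk p ⧸ stalkIdealOf X.ideal.toIdeal p) :=
    Ideal.Quotient.nontrivial_iff.2 fun h =>
      (maximalIdeal.isMaximal _).ne_top (top_le_iff.1 (h ▸ hle))
  have : IsLocalRing (ambientStalk p ⧸ stalkIdealOf X.ideal.toIdeal p) :=
    .of_surjective' _ Ideal.Quotient.mk_surjective
  refine ⟨rs.length, ?_, hdim.symm⟩
  have h := (depthGE_of_isRegular (R := ambientStalk p ⧸ stalkIdealOf X.ideal.toIdeal p)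
    hrs).comap_of_surjective _ Ideal.Quotient.mk_surjective
  rw [← RingHom.ker_eq_comap_bot, Ideal.mk_ker] at h
  exact h.mono (le_maximalIdeal (Ideal.comap_ne_top _ (maximalIdeal.isMaximal _).ne_top))

/-- A Cohen-Macaulay subscheme has no embedded points. -/
theorem eq_of_le_of_isAssoc {X : ProjSubscheme k V} (hX : X.IsCohenMacaulay)
    (hp : p ∈ X.support) {G : CoordRing k V} (hG : SetLike.IsHomogeneousElem (grading k V) G)
    (hpG : ∀ b, b ∈ p.asHomogeneousIdeal.toIdeal ↔ b * G ∈ X.ideal.toIdeal)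
    {y : ProjectiveSpectrum (grading k V)} (hy : y ∈ X.support) (hyp : y ≤ p) : y = p := by
  obtain ⟨l, hl⟩ := exists_linForm_notMem p
  obtain ⟨n, hdepth, hdim⟩ := exists_depthGE_stalkIdealOf hX hp
  -- The class of `G` is nonzero at `p` and killed by the maximal ideal, so no element of the
  -- maximal ideal is regular. The stalk has depth, hence dimension, zero, leaving no room for a
  -- point `y` strictly below `p`.
  have hn : n = 0 := by
    cases hdepth with
    | zero => rfl
    | @succ n _ x hx hreg =>
      exfalso
      obtain ⟨a, ha, hiff⟩ := exists_dehom_mem_iff hl x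
      have hap : a ∈ p.asHomogeneousIdeal.toIdeal :=
        (dehom_mem_maximalIdeal hl ha).1 ((hiff _).2 hx)
      have h1 : dehom hl a ∈ (stalkIdealOf X.ideal.toIdeal p).colon {dehom hl G} := by
        rw [Submodule.mem_colon_singleton, smul_eq_mul, ← map_mul]
        exact dehom_mem_stalkIdealOf_of_mem hl X.ideal.isHomogeneous ((hpG a).1 hap)
      have h2 := (hiff _).1 h1
      rw [Submodule.mem_colon_singleton, smul_eq_mul] at h2
      obtain ⟨s, hs, hsG⟩ := (dehom_mem_stalkIdealOf_iff hl hG).1 (hreg _ h2)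
      exact hs ((hpG s).2 hsG)
  subst hn
  have hyp' : y.asHomogeneousIdeal.toIdeal ≤ p.asHomogeneousIdeal.toIdeal := hyp
  have hprime := stalkIdealOf_isPrime y.isPrime hyp'
  refine le_antisymm hyp (le_of_maximalIdeal_le y.isPrime hyp' ?_)
  by_contra hcon
  have h1 := ringKrullDim_quotient_succ_le_of_lt
    (lt_of_le_not_ge (stalkIdealOf_le_maximalIdeal hyp') hcon)
  have h2 := ringKrullDim_quotient_le_of_le (stalkIdealOf_mono (p := p) (mem_zeroLocus_ideal.1 hy))
  rw [hdim] at h2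
  have h3 : 0 ≤ ringKrullDim (ambientStalk p ⧸ maximalIdeal (ambientStalk p)) :=
    ringKrullDim_nonneg_of_nontrivial
  have h4 := ((add_le_add_left h3 1).trans h1).trans h2
  exact absurd h4 (by norm_num)

variable [FiniteDimensional k V]

/-- Parameters of the local ring of `V(P)` at `p` are represented by forms; `p` is then minimal over
`P` plus these forms, and catenarity at the vertex of affine space bounds the dimension drop by
their number. -/
theorem le_add_ringKrullDim_stalk {P : Ideal (CoordRing k V)} (hP : P.IsPrime)
    (hhom : P.IsHomogeneous (grading k V)) (hle : P ≤ p.asHomogeneousIdeal.toIdeal) {a b n : ℕ}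
    (ha : a ≤ locDim (irrel k V) P)
    (hb : locDim (irrel k V) p.asHomogeneousIdeal.toIdeal ≤ b)
    (hn : ringKrullDim (ambientStalk p ⧸ stalkIdealOf P p) ≤ n) : a ≤ b + n := by
  classical
  obtain ⟨l, hl⟩ := exists_linForm_notMem p
  have hprime := stalkIdealOf_isPrime hP hle
  have : IsLocalRing (ambientStalk p ⧸ stalkIdealOf P p) :=
    .of_surjective' _ Ideal.Quotient.mk_surjective
  obtain ⟨s, hs, hcard⟩ := (maximalIdeal
    (ambientStalk p ⧸ stalkIdealOf P p)).exists_finset_card_eq_height_of_isNoetherianRing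
  rw [← maximalIdeal_height_eq_ringKrullDim, ← hcard] at hn
  have hcard' : s.card ≤ n := by exact_mod_cast hn
  have hlift : ∀ x : ambientStalk p ⧸ stalkIdealOf P p, ∃ c,
      SetLike.IsHomogeneousElem (grading k V) c ∧ ∀ J : Ideal (ambientStalk p),
        stalkIdealOf P p ≤ J → (dehom hl c ∈ J ↔ x ∈ J.map (Ideal.Quotient.mk _)) := by
    intro x
    obtain ⟨r, rfl⟩ := Ideal.Quotient.mk_surjective x
    obtain ⟨c, hc, hiff⟩ := exists_dehom_mem_iff hl r
    refine ⟨c, hc, fun J hJ => (hiff J).trans ?_⟩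
    rw [Ideal.mem_quotient_iff_mem_sup, sup_of_le_left hJ]
  choose c hc hiff using hlift
  have hcp : ∀ x ∈ s, c x ∈ p.asHomogeneousIdeal.toIdeal := by
    intro x hx
    rw [← dehom_mem_maximalIdeal hl (hc x), hiff x _ (le_maximalIdeal hprime.ne_top),
      IsLocalRing.map_maximalIdeal_of_surjective _ Ideal.Quotient.mk_surjective]
    exact hs.1.2 (Ideal.subset_span hx)
  let L := s.toList.map c
  have hLp : P ⊔ Ideal.ofList L ≤ p.asHomogeneousIdeal.toIdeal := by
    refine sup_le hle (Ideal.span_le.2 ?_)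
    intro x hx
    obtain ⟨y, hy, rfl⟩ := List.mem_map.1 hx
    exact hcp y (Finset.mem_toList.1 hy)
  have hLhom : (P ⊔ Ideal.ofList L).IsHomogeneous (grading k V) := by
    refine hhom.sup (Ideal.homogeneous_span _ _ ?_)
    intro x hx
    obtain ⟨y, -, rfl⟩ := List.mem_map.1 hx
    exact hc y
  have hpprime := p.isPrime
  obtain ⟨Q, hQ, hQp⟩ := Ideal.exists_minimalPrimes_le hLp
  have hQprime := hQ.1.1
  have hQs := stalkIdealOf_isPrime hQprime hQp
  have hPQ : stalkIdealOf P p ≤ stalkIdealOf Q p := stalkIdealOf_mono (le_sup_left.trans hQ.1.2)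
  have hker : RingHom.ker (Ideal.Quotient.mk (stalkIdealOf P p)) ≤ stalkIdealOf Q p := by
    rwa [Ideal.mk_ker]
  have hmapprime := Ideal.map_isPrime_of_surjective
    (Ideal.Quotient.mk_surjective (I := stalkIdealOf P p)) hker
  have hspan : Ideal.span (s : Set _) ≤
      (stalkIdealOf Q p).map (Ideal.Quotient.mk (stalkIdealOf P p)) := by
    refine Ideal.span_le.2 fun x hx => (hiff x _ hPQ).1 ?_
    refine dehom_mem_stalkIdealOf_of_mem hl (isHomogeneous_of_mem_minimalPrimes hLhom hQ)
      (hQ.1.2 (Ideal.mem_sup_right (Ideal.subset_span ?_)))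
    exact List.mem_map.2 ⟨x, Finset.mem_toList.2 hx, rfl⟩
  have hmax := hs.2 ⟨hmapprime, hspan⟩ (le_maximalIdeal hmapprime.ne_top)
  -- The stalk ideal of `Q` contains the chosen parameters, over which the maximal ideal is minimal,
  -- so it is the maximal ideal.
  have hpQ : p.asHomogeneousIdeal.toIdeal ≤ Q := by
    refine le_of_maximalIdeal_le hQprime hQp ?_
    rw [← IsLocalRing.map_maximalIdeal_of_surjective (Ideal.Quotient.mk (stalkIdealOf P p))
      Ideal.Quotient.mk_surjective, Ideal.map_le_iff_le_comap,
      Ideal.comap_map_of_surjective _ Ideal.Quotient.mk_surjective,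
      ← RingHom.ker_eq_comap_bot, sup_of_le_left hker] at hmax
    exact hmax
  have heq : Q = p.asHomogeneousIdeal.toIdeal := le_antisymm hQp hpQ
  have : IsNoetherianRing (CoordRing k V) := isNoetherianRing_coordRing
  have h := (locDepthGE_finrank k V).le_add_length_of_mem_minimalPrimes (locDim_bot_le k V)
    hQ (hQp.trans (lt_irrel p).le) ha (heq ▸ hb)
  have hlen : L.length = s.card := by simp [L]
  omega

/-- Local comparison of a subscheme with a larger one that has the same linear section. -/
theorem stalkIdealOf_le_of_linearSection {X : ProjSubscheme k V} (hX : X.IsCohenMacaulay)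
    (hp : p ∈ X.support) {E : Ideal (CoordRing k V)} (hE : E.IsHomogeneous (grading k V))
    (hEX : E ≤ X.ideal.toIdeal) {L : List (CoordRing k V)}
    (hlin : ∀ x ∈ L, SetLike.IsHomogeneousElem (grading k V) x)
    (hpL : p.asHomogeneousIdeal.toIdeal ∈
      (X.ideal.toIdeal ⊔ Ideal.ofList L).minimalPrimes)
    (hsec : ∀ F ∈ X.ideal.toIdeal, ∀ l : Module.Dual k V, ∃ n : ℕ,
      linForm k V l ^ n * F ∈ E ⊔ Ideal.ofList L)
    {P : Ideal (CoordRing k V)} (hP : P.IsPrime) (hPhom : P.IsHomogeneous (grading k V))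
    (hXP : X.ideal.toIdeal ≤ P) (hPp : P ≤ p.asHomogeneousIdeal.toIdeal) {d : ℕ}
    (hPd : ((d + L.length : ℕ) : WithBot ℕ∞) ≤ locDim (irrel k V) P)
    (hpd : locDim (irrel k V) p.asHomogeneousIdeal.toIdeal ≤ d) :
    stalkIdealOf X.ideal.toIdeal p ≤ stalkIdealOf E p := by
  obtain ⟨l, hl⟩ := exists_linForm_notMem p
  obtain ⟨n, hdepth, hdim⟩ := exists_depthGE_stalkIdealOf hX hp
  -- The component `V(P)` of dimension at least `d + |L|` passes through `p` of dimension at most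
  -- `d`, so the stalk has dimension at least `|L|`.
  have hn : L.length ≤ n := by
    have h := le_add_ringKrullDim_stalk hP hPhom hPp hPd hpd
      ((ringKrullDim_quotient_le_of_le (stalkIdealOf_mono hXP)).trans hdim.le)
    omega
  have hLp : ∀ x ∈ L, x ∈ p.asHomogeneousIdeal.toIdeal := fun x hx =>
    hpL.1.2 (Ideal.mem_sup_right (Ideal.subset_span hx))
  have hLmap : (Ideal.ofList L).map (dehom hl) = Ideal.ofList (L.map (dehom hl)) :=
    Ideal.map_ofList _ _
  have hmap : ∀ {I : Ideal (CoordRing k V)}, I.IsHomogeneous (grading k V) →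
      I.map (dehom hl) ≤ stalkIdealOf I p := fun hI =>
    Ideal.map_le_iff_le_comap.2 fun F hF => dehom_mem_stalkIdealOf_of_mem hl hI hF
  refine DepthGE.le_of_sup_ofList_eq (L := L.map (dehom hl)) (stalkIdealOf_mono hEX) ?_ ?_ ?_ ?_
  · intro x hx
    obtain ⟨y, hy, rfl⟩ := List.mem_map.1 hx
    exact (dehom_mem_maximalIdeal hl (hlin y hy)).2 (hLp y hy)
  -- Primes of the stalk over `I + (L)` contract to primes whose homogeneous core lies between this
  -- ideal and `p`; minimality of `p` leaves only the maximal ideal.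
  · refine ringKrullDim_quotient_le_zero fun q hq hle => ?_
    refine le_antisymm (le_maximalIdeal hq.ne_top) ?_
    have hq' : (q.comap (dehom hl)).IsPrime := Ideal.comap_isPrime _ _
    have hle' : (X.ideal.toIdeal ⊔ Ideal.ofList L) ≤ q.comap (dehom hl) := by
      rw [← Ideal.map_le_iff_le_comap, Ideal.map_sup, hLmap]
      exact (sup_le_sup_right (hmap X.ideal.isHomogeneous) _).trans hle
    have hhom : (X.ideal.toIdeal ⊔ Ideal.ofList L).IsHomogeneous (grading k V) :=
      X.ideal.isHomogeneous.sup (Ideal.homogeneous_span _ _ hlin)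
    have hcore : (X.ideal.toIdeal ⊔ Ideal.ofList L) ≤
        ((q.comap (dehom hl)).homogeneousCore (grading k V)).toIdeal :=
      hhom.toIdeal_homogeneousCore_eq_self.symm.le.trans
        (Ideal.homogeneousCore_mono (grading k V) hle')
    have hcp : ((q.comap (dehom hl)).homogeneousCore (grading k V)).toIdeal ≤
        p.asHomogeneousIdeal.toIdeal :=
      isHomogeneous_le_of_forall (HomogeneousIdeal.isHomogeneous _) fun F hF hFq =>
        (dehom_mem_maximalIdeal hl hF).1
          (le_maximalIdeal hq.ne_top
            (Ideal.toIdeal_homogeneousCore_le (grading k V) (q.comap (dehom hl)) hFq))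
    have hpc := hpL.2 ⟨hq'.homogeneousCore, hcore⟩ hcp
    exact le_of_dehom hl fun a ha ham =>
      Ideal.toIdeal_homogeneousCore_le (grading k V) (q.comap (dehom hl)) (hpc ((dehom_mem_maximalIdeal hl ha).1 ham))
  · rw [List.length_map]
    exact hdepth.of_le hn
  -- The saturation factor is harmless: dehomogenizing with respect to `l` sends it to one. The
  -- denominator is first made homogeneous so that its image is a unit.
  · refine sup_le (le_of_dehom hl fun a ha haI => ?_) le_sup_right
    obtain ⟨s, hs, hsa⟩ := (dehom_mem_stalkIdealOf_iff hl ha).1 haI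
    obtain ⟨t, ht, hthom, hta⟩ := exists_isHomogeneous_mul_mem ha X.ideal.isHomogeneous hs hsa
    obtain ⟨N, hN⟩ := hsec _ hta l
    have h1 := Ideal.mem_map_of_mem (dehom hl) hN
    rw [map_mul, map_pow, dehom_linForm_self, one_pow, one_mul, map_mul, Ideal.map_sup, hLmap,
      Ideal.unit_mul_mem_iff_mem _ ((isUnit_dehom hl hthom).2 ht)] at h1
    exact sup_le_sup_right (hmap hE) _ h1

end StalkIdeal

end ProjLinear

namespace ProjLinear

/-! ### Linear sections of Cohen-Macaulay subschemes -/

section LinearSections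

open IsLocalRing ProjSubscheme

variable {k : Type*} [Field k]
variable {V : Type*} [AddCommGroup V] [Module k V]
variable {W : Type*} [AddCommGroup W] [Module k W]

theorem exists_pow_mul_mem_of_mem_map {φ : V →ₗ[k] W} {I : Ideal (CoordRing k V)}
    {J : Ideal (CoordRing k W)} {t : CoordRing k V}
    (h : ∀ F ∈ J, ∃ n : ℕ, t ^ n * pullHom φ F ∈ I) {G : CoordRing k V}
    (hG : G ∈ J.map (pullHom φ).toRingHom) : ∃ n : ℕ, t ^ n * G ∈ I := by
  induction hG using Submodule.span_induction with
  | mem x hx =>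
    obtain ⟨F, hF, rfl⟩ := hx
    exact h F hF
  | zero => exact ⟨0, by simp⟩
  | add x y _ _ hx hy =>
    obtain ⟨m, hm⟩ := hx
    obtain ⟨n, hn⟩ := hy
    refine ⟨m + n, ?_⟩
    have h1 := I.add_mem (I.mul_mem_left (t ^ n) hm) (I.mul_mem_left (t ^ m) hn)
    convert h1 using 1
    ring
  | smul a x _ hx =>
    obtain ⟨n, hn⟩ := hx
    refine ⟨n, ?_⟩
    have h1 := I.mul_mem_left a hn
    convert h1 using 1
    rw [smul_eq_mul]
    ring

theorem isHomogeneous_map_pullHom (φ : V →ₗ[k] W) {I : Ideal (CoordRing k W)}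
    (hI : I.IsHomogeneous (grading k W)) :
    (I.map (pullHom φ).toRingHom).IsHomogeneous (grading k V) :=
  (HomogeneousIdeal.map (pullForms φ).toGradedRingHom
    (⟨I, hI⟩ : HomogeneousIdeal (grading k W))).isHomogeneous

theorem add_natCast_le_cancel {a n : ℕ} {x : WithBot ℕ∞}
    (h : ((a + n : ℕ) : WithBot ℕ∞) ≤ x + n) : (a : WithBot ℕ∞) ≤ x := by
  induction x with
  | bot => simp at h
  | coe x =>
    induction x with
    | top => exact_mod_cast le_top
    | coe x =>
      have h' : a + n ≤ x + n := by exact_mod_cast h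
      have : a ≤ x := by omega
      exact_mod_cast this

/-- Arithmetic Cohen–Macaulayness is used only at the vertex of the affine cone. -/
theorem locDepthGE_of_isACM {Y : ProjSubscheme k W} (hY : Y.IsACM)
    (hle : Y.ideal.toIdeal ≤ irrel k W) {a : ℕ}
    (ha : locDim (irrel k W) Y.ideal.toIdeal = a) :
    LocDepthGE (irrel k W) a Y.ideal.toIdeal := by
  have hsurj := Ideal.Quotient.mk_surjective (I := Y.ideal.toIdeal)
  have hker : RingHom.ker (Ideal.Quotient.mk Y.ideal.toIdeal) ≤ irrel k W := by
    rwa [Ideal.mk_ker]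
  have hprime := Ideal.map_isPrime_of_surjective hsurj hker
  set q := (irrel k W).map (Ideal.Quotient.mk Y.ideal.toIdeal) with hq
  have hpq : irrel k W = q.comap (Ideal.Quotient.mk Y.ideal.toIdeal) := by
    rw [hq, Ideal.comap_map_of_surjective _ hsurj, ← RingHom.ker_eq_comap_bot, sup_of_le_left hker]
  have hbot : (⊥ : Ideal (CoordRing k W ⧸ Y.ideal.toIdeal)).comap (Ideal.Quotient.mk _) =
      Y.ideal.toIdeal := by
    rw [← RingHom.ker_eq_comap_bot, Ideal.mk_ker]
  obtain ⟨-, rs, hrs, hdim⟩ := hY.2 q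
  have h1 : LocDepthGE q rs.length ⊥ := by
    have h := depthGE_of_isRegular hrs
    rw [LocDepthGE, Ideal.map_bot]
    exact h
  have h2 : locDim q ⊥ = rs.length := by
    rw [locDim, Ideal.map_bot, hdim]
    exact ringKrullDim_eq_of_ringEquiv (RingEquiv.quotientBot _)
  rw [← locDepthGE_comap_iff hsurj (irrel k W) q hpq, hbot] at h1
  rw [← locDim_comap hsurj (irrel k W) q hpq, hbot, ha] at h2
  have h3 : a = rs.length := by exact_mod_cast h2
  rwa [h3]

variable [FiniteDimensional k V] [FiniteDimensional k W]

/-- If all forms `l ∘ g` were in `Q`, its zero set would lie in `Ker g`, whose dimension is too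
small. -/
theorem exists_linForm_comp_notMem {g : V →ₗ[k] W} (hg : Function.Surjective g)
    {Q : Ideal (CoordRing k V)}
    (h : ((Module.finrank k (LinearMap.ker g) + 1 : ℕ) : WithBot ℕ∞) ≤ locDim (irrel k V) Q) :
    ∃ l : Module.Dual k W, linForm k V (l ∘ₗ g) ∉ Q := by
  by_contra! hcon
  have hinj : Function.Injective (LinearMap.ker g).subtype := Subtype.val_injective
  obtain ⟨L, hL, -, hker⟩ := exists_forms (k := k) hinj
  have hLQ : ⊥ ⊔ Ideal.ofList L ≤ Q := by
    refine sup_le bot_le (Ideal.span_le.2 fun x hx => ?_)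
    obtain ⟨l, rfl, hl⟩ := hL x hx
    obtain ⟨s, hs⟩ := g.exists_rightInverse_of_surjective (LinearMap.range_eq_top.2 hg)
    -- A form vanishing on `Ker g` factors through `g`; any section `s` of `g` gives the
    -- factorization.
    have hl' : l = (l ∘ₗ s) ∘ₗ g := by
      ext v
      have hv : v - s (g v) ∈ LinearMap.ker g := by
        rw [LinearMap.mem_ker, map_sub, sub_eq_zero]
        exact (LinearMap.congr_fun hs (g v)).symm
      have h1 : l (v - s (g v)) = 0 := LinearMap.congr_fun hl ⟨_, hv⟩
      rw [map_sub, sub_eq_zero] at h1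
      exact h1
    rw [hl']
    exact hcon _
  have h1 := h.trans (locDim_anti hLQ)
  rw [← locDim_map_pullHom hinj hker, Ideal.map_bot] at h1
  have h2 := h1.trans (locDim_bot_le k _)
  have h3 : Module.finrank k (LinearMap.ker g) + 1 ≤ Module.finrank k (LinearMap.ker g) := by
    exact_mod_cast h2
  omega

theorem not_irrel_le_of_one_le_locDim {Q : Ideal (CoordRing k V)}
    (h : ((1 : ℕ) : WithBot ℕ∞) ≤ locDim (irrel k V) Q) : ¬ irrel k V ≤ Q := by
  intro hle
  obtain ⟨l, hl⟩ := exists_linForm_comp_notMem (g := (LinearMap.id : V →ₗ[k] V))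
    Function.surjective_id (Q := Q) (by rwa [LinearMap.ker_id, finrank_bot])
  exact hl (hle (linForm_mem_irrel _))

theorem nonempty_zeroLocus_of_one_le_locDim [Infinite k] {J : Ideal (CoordRing k V)}
    (hJ : J.IsHomogeneous (grading k V))
    (h : ((1 : ℕ) : WithBot ℕ∞) ≤ locDim (irrel k V) J) :
    (ProjectiveSpectrum.zeroLocus (grading k V) (J : Set (CoordRing k V))).Nonempty := by
  by_contra hne
  rw [Set.not_nonempty_iff_eq_empty] at hne
  have h1 := h.trans (locDim_le_of_krullDim_lt 0 hJ (by
    rw [hne, Order.krullDim_eq_bot]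
    simp))
  have h2 : 1 ≤ 0 := by exact_mod_cast h1
  omega

theorem locDim_map_pullHom_le {j : V →ₗ[k] W} (hj : Function.Injective j)
    (I : Ideal (CoordRing k W)) :
    locDim (irrel k V) (I.map (pullHom j).toRingHom) ≤ locDim (irrel k W) I := by
  obtain ⟨L, -, -, hker⟩ := exists_forms (k := k) hj
  rw [locDim_map_pullHom hj hker]
  exact locDim_anti le_sup_left

/-- An inclusion into `E` can fail only at an associated prime of `E`, and the depth bounds the
dimension of those from below. What remains is to refute one such prime `Q`, the annihilator of a
form `G ∈ J` modulo `E`. -/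
theorem le_of_locDepthGE {E J : Ideal (CoordRing k V)} (hE : E.IsHomogeneous (grading k V))
    (hJ : J.IsHomogeneous (grading k V)) {n : ℕ} (hn : LocDepthGE (irrel k V) n E)
    (h : ∀ (G : CoordRing k V) (Q : Ideal (CoordRing k V)),
      SetLike.IsHomogeneousElem (grading k V) G → G ∈ J → Q.IsPrime →
      Q.IsHomogeneous (grading k V) → (∀ b, b ∈ Q ↔ b * G ∈ E) →
      (n : WithBot ℕ∞) ≤ locDim (irrel k V) Q → False) : J ≤ E := by
  refine isHomogeneous_le_of_forall hJ fun F hF hFJ => ?_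
  by_contra hFE
  obtain ⟨G, hG, ⟨H, rfl⟩, -, Q, hQ, hQhom, hQG⟩ := exists_isHomogeneous_isAssoc hE hF hFE
  exact h _ Q hG (J.mul_mem_left H hFJ) hQ hQhom hQG
    (hn.le_locDim ⟨hQ, _, hQG⟩ (le_irrel_of_isHomogeneous hQhom hQ.ne_top))

/-- The analogue of `le_of_locDepthGE` without depth at the vertex. Saturation makes associated
primes of `X` relevant, the Cohen–Macaulay condition on stalks makes them minimal, and pure
dimension then gives them dimension `d + 1`. -/
theorem le_ideal_of_isCohenMacaulay [Infinite k] {X : ProjSubscheme k V}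
    (hX : X.IsCohenMacaulay) (hpure : X.IsPureDimensional) {d : ℕ} (hd : X.dim = d)
    {J : Ideal (CoordRing k V)} (hJ : J.IsHomogeneous (grading k V))
    (h : ∀ (G : CoordRing k V) (Q : Ideal (CoordRing k V)),
      SetLike.IsHomogeneousElem (grading k V) G → G ∈ J → Q.IsPrime →
      Q.IsHomogeneous (grading k V) → (∀ b, b ∈ Q ↔ b * G ∈ X.ideal.toIdeal) →
      ((d + 1 : ℕ) : WithBot ℕ∞) ≤ locDim (irrel k V) Q → False) : J ≤ X.ideal.toIdeal := by
  refine isHomogeneous_le_of_forall hJ fun F hF hFJ => ?_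
  by_contra hFE
  obtain ⟨G, hG, ⟨H, rfl⟩, hGX, Q, hQ, hQhom, hQG⟩ :=
    exists_isHomogeneous_isAssoc X.ideal.isHomogeneous hF hFE
  have hrel : ¬ irrel k V ≤ Q := fun hle => hGX (X.saturation_le fun l =>
    ⟨1, by rw [pow_one]; exact (hQG _).1 (hle (linForm_mem_irrel l))⟩)
  have hmem : pointOf Q hQ hQhom hrel ∈ X.support :=
    mem_zeroLocus_ideal.2 fun b hb => (hQG b).2 (X.ideal.toIdeal.mul_mem_right _ hb)
  exact h _ Q hG (J.mul_mem_left H hFJ) hQ hQhom hQG (locDim_eq_of_isPureDimensional hpure hmem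
    (fun y hy hle => eq_of_le_of_isAssoc hX hmem hG hQG hy hle) hd).ge

/-- Associated primes of `X` are too large in dimension to lie inside the centre of the projection,
so each misses some `l ∘ g`, a power of which carries `G` into the ideal of `X`. -/
theorem map_pullHom_le_of_mapsInto [Infinite k] {U : Type*} [AddCommGroup U] [Module k U]
    {X : ProjSubscheme k V} (hX : X.IsCohenMacaulay) (hpure : X.IsPureDimensional) {d : ℕ}
    (hd : X.dim = d) {g : V →ₗ[k] W} (hg : Function.Surjective g) {j : W →ₗ[k] U}
    (hj : Function.Injective j) (hgd : Module.finrank k (LinearMap.ker g) ≤ d)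
    {Y : ProjSubscheme k U} (hXY : X.MapsInto (j ∘ₗ g) Y) :
    Y.ideal.toIdeal.map (pullHom (j ∘ₗ g)).toRingHom ≤ X.ideal.toIdeal := by
  refine le_ideal_of_isCohenMacaulay hX hpure hd
    (isHomogeneous_map_pullHom _ Y.ideal.isHomogeneous) fun G Q _ hG hQ _ hQG hQd => ?_
  obtain ⟨l₀, hl₀⟩ := exists_linForm_comp_notMem hg (Q := Q)
    (le_trans (by exact_mod_cast Nat.succ_le_succ hgd) hQd)
  obtain ⟨l, rfl⟩ := LinearMap.dualMap_surjective_of_injective hj l₀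
  obtain ⟨n, hn⟩ := exists_pow_mul_mem_of_mem_map (t := linForm k V ((j.dualMap l) ∘ₗ g))
    (fun F hF => hXY F hF l) hG
  exact hl₀ (hQ.mem_of_pow_mem n ((hQG _).2 hn))

/-- The cone is saturated twice, on `W` and on `V`. Each associated prime of the unsaturated ideal
misses some `l₀ ∘ g`, and powers of this one form absorb both saturations. -/
theorem cone_linearSection_ideal {U : Type*} [AddCommGroup U] [Module k U]
    {g : V →ₗ[k] W} (hg : Function.Surjective g) (j : W →ₗ[k] U) (Y : ProjSubscheme k U)
    (h : LocDepthGE (irrel k V) (Module.finrank k (LinearMap.ker g) + 1)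
      (Y.ideal.toIdeal.map (pullHom (j ∘ₗ g)).toRingHom)) :
    ((Y.linearSection j).cone g).ideal.toIdeal =
      Y.ideal.toIdeal.map (pullHom (j ∘ₗ g)).toRingHom := by
  have hE := map_pullHom_comp j g Y.ideal.toIdeal
  refine le_antisymm ?_ ?_
  · refine le_of_locDepthGE (isHomogeneous_map_pullHom _ Y.ideal.isHomogeneous)
      (HomogeneousIdeal.isHomogeneous _) h fun G Q _ hG hQ _ hQG hQd => ?_
    obtain ⟨l₀, hl₀⟩ := exists_linForm_comp_notMem hg hQd
    obtain ⟨m, hm⟩ := mem_saturation.1 hG (l₀ ∘ₗ g)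
    obtain ⟨n, hn⟩ := exists_pow_mul_mem_of_mem_map (φ := g)
      (J := (Y.linearSection j).ideal.toIdeal)
      (I := Y.ideal.toIdeal.map (pullHom (j ∘ₗ g)).toRingHom) (t := linForm k V (l₀ ∘ₗ g))
      (fun F hF => by
        obtain ⟨n, hn⟩ := mem_saturation.1 hF l₀
        refine ⟨n, ?_⟩
        rw [hE, ← pullHom_linForm, ← map_pow, ← map_mul]
        exact Ideal.mem_map_of_mem (pullHom g).toRingHom hn) hm
    rw [← mul_assoc, ← pow_add] at hn
    exact hl₀ (hQ.mem_of_pow_mem _ ((hQG _).2 hn))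
  · rw [hE]
    refine le_trans (Ideal.map_mono ?_) (le_saturation ((Y.linearSection j).ideal.map
      (pullForms g).toGradedRingHom))
    exact le_saturation (Y.ideal.map (pullForms j).toGradedRingHom)

/-- A homogeneous ideal `E` of sufficient depth contained in the ideal of a Cohen-Macaulay subscheme
`X` is the ideal of `X` if both have the same transverse linear section. -/
theorem ideal_le_of_linearSection [Infinite k] {X : ProjSubscheme k V}
    (hX : X.IsCohenMacaulay) (hpure : X.IsPureDimensional) {d e : ℕ} (hd : X.dim = d)
    {L : List (CoordRing k V)} (hL : ∀ x ∈ L, ∃ l, x = linForm k V l)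
    (hde : d + 1 = e + 1 + L.length) {E : Ideal (CoordRing k V)}
    (hE : E.IsHomogeneous (grading k V)) (hdepth : LocDepthGE (irrel k V) (e + 1 + L.length) E)
    (hEX : E ≤ X.ideal.toIdeal)
    (hsec : ∀ F ∈ X.ideal.toIdeal, ∀ l : Module.Dual k V, ∃ n : ℕ,
      linForm k V l ^ n * F ∈ E ⊔ Ideal.ofList L)
    (hEL : locDim (irrel k V) (E ⊔ Ideal.ofList L) ≤ ((e + 1 : ℕ) : WithBot ℕ∞)) :
    X.ideal.toIdeal ≤ E := by
  have hlin : ∀ x ∈ L, SetLike.IsHomogeneousElem (grading k V) x := by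
    intro x hx
    obtain ⟨l, rfl⟩ := hL x hx
    exact ⟨1, linForm_mem k V l⟩
  have hLirrel : ∀ x ∈ L, x ∈ irrel k V := by
    intro x hx
    obtain ⟨l, rfl⟩ := hL x hx
    exact linForm_mem_irrel l
  refine le_of_locDepthGE hE X.ideal.isHomogeneous hdepth fun G Q hGhom hG hQ hQhom hQG hQd => ?_
  have hQL : (Q ⊔ Ideal.ofList L).IsHomogeneous (grading k V) :=
    hQhom.sup (Ideal.homogeneous_span _ _ hlin)
  -- `Q` has dimension at least `e + 1 + |L|` at the vertex, so `|L|` linear forms leave a component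
  -- of dimension at least `e + 1 ≥ 1`: an actual point `p` of projective space.
  obtain ⟨p, hp, hpirrel, hpd⟩ := exists_minimalPrimes_le_locDim
    (add_natCast_le_cancel (hQd.trans (locDim_le_add_length Q hLirrel)))
  have hpprime := hp.1.1
  have hQp : Q ≤ p := le_sup_left.trans hp.1.2
  have hLp : Ideal.ofList L ≤ p := le_sup_right.trans hp.1.2
  have hEp : E ≤ p := fun b hb => hQp ((hQG b).2 (E.mul_mem_right _ hb))
  have hrel : ¬ irrel k V ≤ p := not_irrel_le_of_one_le_locDim
    (le_trans (by exact_mod_cast Nat.le_add_left 1 e) hpd)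
  let y := pointOf p hpprime (isHomogeneous_of_mem_minimalPrimes hQL hp) hrel
  have hXp : X.ideal.toIdeal ≤ p := by
    intro F hF
    obtain ⟨l, hl⟩ := exists_linForm_notMem y
    obtain ⟨n, hn⟩ := hsec F hF l
    exact (hpprime.mem_or_mem (sup_le hEp hLp hn)).resolve_left fun h =>
      hl (hpprime.mem_of_pow_mem n h)
  -- A prime strictly below `p` would have dimension at least `e + 2`, more than `E + (L)` allows.
  have hpmin : p ∈ (X.ideal.toIdeal ⊔ Ideal.ofList L).minimalPrimes := by
    refine ⟨⟨hpprime, sup_le hXp hLp⟩, fun q hq hle => ?_⟩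
    by_contra hcon
    have hqprime := hq.1
    have h1 := (add_le_add_left hpd 1).trans
      (locDim_succ_le_of_lt (lt_of_le_not_ge hle hcon) hpirrel)
    have h2 := h1.trans ((locDim_anti ((sup_le_sup_right hEX _).trans hq.2)).trans hEL)
    have h3 : e + 1 + 1 ≤ e + 1 := by exact_mod_cast h2
    omega
  obtain ⟨P, hP, hPp⟩ := Ideal.exists_minimalPrimes_le hXp
  have hPhom := isHomogeneous_of_mem_minimalPrimes X.ideal.isHomogeneous hP
  have hPd := locDim_eq_of_isPureDimensional hpure
    (x := pointOf P hP.1.1 hPhom fun h => hrel (h.trans hPp)) hP.1.2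
    (fun z hz hle => le_antisymm hle (hP.2 ⟨z.isPrime, hz⟩ hle)) hd
  rw [hde] at hPd
  have hstalk := stalkIdealOf_le_of_linearSection (p := y) hX hXp hE hEX hlin hpmin hsec
    hP.1.1 hPhom hP.1.2 hPp hPd.ge ((locDim_anti (sup_le hEp hLp)).trans hEL)
  -- Equality of the stalks gives `s * G ∈ E` with `s ∉ p`; but then `s ∈ Q ≤ p`.
  obtain ⟨l, hl⟩ := exists_linForm_notMem y
  obtain ⟨s, hs, hsG⟩ := (dehom_mem_stalkIdealOf_iff hl hGhom).1
    (hstalk (dehom_mem_stalkIdealOf_of_mem hl X.ideal.isHomogeneous hG))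
  exact hs (hQp ((hQG s).2 hsG))

end LinearSections

end ProjLinear

/-! ### The main theorem -/

theorem proposition5p9
    {k : Type*} [Field k] [IsAlgClosed k] [CharZero k]
    {W W₀ W₁ W₂ : Type*}
    [AddCommGroup W] [Module k W] [FiniteDimensional k W]
    [AddCommGroup W₀] [Module k W₀] [FiniteDimensional k W₀]
    [AddCommGroup W₁] [Module k W₁] [FiniteDimensional k W₁]
    [AddCommGroup W₂] [Module k W₂] [FiniteDimensional k W₂]
    (i : W₂ →ₗ[k] W₁) (g : W₁ →ₗ[k] W₀) (j : W₀ →ₗ[k] W)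
    (hi : Function.Injective i) (hg : Function.Surjective g) (hj : Function.Injective j)
    (hinj : Function.Injective (j ∘ₗ g ∘ₗ i))
    (Y : ProjLinear.ProjSubscheme k W) (hY : Y.IsACM)
    (hY₂ne : (Y.linearSection (j ∘ₗ g ∘ₗ i)).support.Nonempty)
    (hY₂ : Y.IsDimTransverse (j ∘ₗ g ∘ₗ i))
    (X : ProjLinear.ProjSubscheme k W₁)
    (hXpure : X.IsPureDimensional) (hXCM : X.IsCohenMacaulay)
    (hXY₂ : X.linearSection i = Y.linearSection (j ∘ₗ g ∘ₗ i))
    (hX : X.IsDimTransverse i)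
    (hXY : X.MapsInto (j ∘ₗ g) Y) :
    Y.IsDimTransverse j ∧ X = (Y.linearSection j).cone g := by
  open ProjLinear in
  have hjg : Function.Injective (g ∘ₗ i) := fun x y h => hinj (congrArg j h)
  obtain ⟨L, hL, hLlen, hker⟩ := exists_forms (k := k) hi
  have hc := LinearMap.finrank_le_finrank_of_injective hj
  have he := LinearMap.finrank_le_finrank_of_injective hjg
  have hg' := LinearMap.finrank_range_add_finrank_ker g
  rw [LinearMap.range_eq_top.2 hg, finrank_top] at hg'
  obtain ⟨c, hc⟩ := Nat.exists_eq_add_of_le' hc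
  obtain ⟨e, he⟩ := Nat.exists_eq_add_of_le' he
  have hYhom := Y.ideal.isHomogeneous
  have hY₀hom := isHomogeneous_map_pullHom j hYhom
  -- dimensions of the subschemes involved
  obtain ⟨d₂, hd₂, hD₂⟩ := exists_dim_eq (Y.linearSection (j ∘ₗ g ∘ₗ i))
    (isHomogeneous_map_pullHom _ hYhom) (support_ofIdeal _) hY₂ne
  have hone : ((1 : ℕ) : WithBot ℕ∞) ≤ ((d₂ + 1 : ℕ) : WithBot ℕ∞) := by
    exact_mod_cast Nat.le_add_left 1 d₂
  obtain ⟨y, hy⟩ : Y.support.Nonempty := nonempty_zeroLocus_of_one_le_locDim hYhom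
    (hone.trans (hD₂.ge.trans (locDim_map_pullHom_le hinj _)))
  obtain ⟨dY, hdY, hDY⟩ := exists_dim_eq Y hYhom rfl ⟨y, hy⟩
  have hcomp : Y.ideal.toIdeal.map (pullHom (j ∘ₗ g ∘ₗ i)).toRingHom =
      (Y.ideal.toIdeal.map (pullHom j).toRingHom).map (pullHom (g ∘ₗ i)).toRingHom :=
    map_pullHom_comp j (g ∘ₗ i) _
  obtain ⟨d₀, hd₀, hD₀⟩ := exists_dim_eq (Y.linearSection j) hY₀hom (support_ofIdeal _) (by
    rw [ProjSubscheme.linearSection, support_ofIdeal]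
    exact nonempty_zeroLocus_of_one_le_locDim hY₀hom
      (hone.trans (hD₂.ge.trans (hcomp ▸ locDim_map_pullHom_le hjg _))))
  obtain ⟨d₂', hd₂', hD₂'⟩ := exists_dim_eq (X.linearSection i)
    (isHomogeneous_map_pullHom _ X.ideal.isHomogeneous) (support_ofIdeal _) (hXY₂ ▸ hY₂ne)
  have hdd : d₂' = d₂ := by
    rw [hXY₂, hd₂] at hd₂'
    exact_mod_cast hd₂'.symm
  subst hdd
  obtain ⟨dX, hdX, hDX⟩ := exists_dim_eq X X.ideal.isHomogeneous rfl
    (nonempty_zeroLocus_of_one_le_locDim X.ideal.isHomogeneous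
      (hone.trans (hD₂'.ge.trans (locDim_map_pullHom_le hi _))))
  have hYnum : d₂' + Module.finrank k W = dY + Module.finrank k W₂ := by
    rw [ProjSubscheme.IsDimTransverse, hd₂, hdY] at hY₂
    exact_mod_cast hY₂
  have hXnum : d₂' + Module.finrank k W₁ = dX + Module.finrank k W₂ := by
    rw [ProjSubscheme.IsDimTransverse, hd₂', hdX] at hX
    exact_mod_cast hX
  -- depth of the cone ideal
  have hdepth : LocDepthGE (irrel k W₁) (d₂' + 1 + L.length)
      (Y.ideal.toIdeal.map (pullHom (j ∘ₗ g)).toRingHom) := by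
    have h1 := locDepthGE_of_isACM hY ((mem_zeroLocus_ideal.1 hy).trans (lt_irrel y).le) hDY
    -- With `c = dim W - dim W₀` and `e = dim W₀ - dim W₂`, transversality of `Y₂` reads `dY = d₂' +
    -- e + c`. The number of equations of `W₂` in `W₁` is `e + dim Ker g`.
    rw [show dY + 1 = d₂' + 1 + e + c by omega] at h1
    have h2 := (h1.map_pullHom hj hjg hc.symm he.symm hD₂.le).map_pullHom_of_surjective hg
      (c := Module.finrank k (LinearMap.ker g)) hg'
    rwa [← map_pullHom_comp, show d₂' + 1 + e + Module.finrank k (LinearMap.ker g) =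
      d₂' + 1 + L.length by omega] at h2
  have hE := isHomogeneous_map_pullHom (j ∘ₗ g) hYhom
  -- The bound `dim Ker g ≤ dX` holds because `dX = d₂' + e + dim Ker g`.
  have hEX := map_pullHom_le_of_mapsInto hXCM hXpure hdX hg hj (by omega) hXY
  have hEi : (Y.ideal.toIdeal.map (pullHom (j ∘ₗ g)).toRingHom).map (pullHom i).toRingHom =
      Y.ideal.toIdeal.map (pullHom (j ∘ₗ g ∘ₗ i)).toRingHom :=
    (map_pullHom_comp (j ∘ₗ g) i _).symm
  have hXE := ideal_le_of_linearSection hXCM hXpure (e := d₂') hdX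
    (fun x hx => (hL x hx).imp fun _ h => h.1) (by omega) hE hdepth hEX
    -- The restriction of `F` to `W₂` is an equation of `X ∩ ℙ(W₂) = Y₂`, so a power of `l` moves it
    -- into the restriction of `E`; back on `W₁` this is membership in `E + (L)`.
    (fun F hF l => by
      have h1 : pullHom i F ∈ (X.linearSection i).ideal :=
        le_saturation (X.ideal.map (pullForms i).toGradedRingHom)
          (Ideal.mem_map_of_mem (pullHom i).toRingHom hF)
      rw [hXY₂] at h1
      obtain ⟨n, hn⟩ := mem_saturation.1 h1 (l ∘ₗ i)
      refine ⟨n, ?_⟩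
      rw [← comap_map_pullHom hi hker, Ideal.mem_comap, hEi]
      rw [← pullHom_linForm, ← map_pow, ← map_mul] at hn
      exact hn)
    (by rw [← locDim_map_pullHom hi hker, hEi, hD₂])
  refine ⟨?_, ?_⟩
  -- The two successive sections lose at most `c` and `e` in dimension, and together exactly `c +
  -- e`, so the first loses exactly `c`.
  · have h1 := locDim_le_locDim_map_add hj hc.symm Y.ideal.toIdeal
    have h2 := locDim_le_locDim_map_add hjg he.symm
      (Y.ideal.toIdeal.map (pullHom j).toRingHom)
    rw [← hcomp, hD₂, hD₀] at h2
    rw [hDY, hD₀] at h1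
    have h1' : dY + 1 ≤ d₀ + 1 + c := by exact_mod_cast h1
    have h2' : d₀ + 1 ≤ d₂' + 1 + e := by exact_mod_cast h2
    rw [ProjSubscheme.IsDimTransverse, hd₀, hdY]
    have h3 : d₀ + Module.finrank k W = dY + Module.finrank k W₀ := by omega
    exact_mod_cast h3
  · have hcone := cone_linearSection_ideal hg j Y (hdepth.of_le (by omega))
    refine ProjSubscheme.ext (HomogeneousIdeal.ext ?_)
    rw [hcone]
    exact le_antisymm hXE hEX
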